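/- Let $a,b>-2$, let $N\ge 2$ be an even integer, and let $w(x)=(1-x)^{a/2}(1+x)^{b/2}$ for $x\in[-1,1]$. Let $f\in C^1[-1,1]$ be complex-valued with $f(-1)=f(1)=0$, and put $$G_N^{(1)}(f)=\frac{\int_{[-1,1]^N}\prod_{1\le j<k\le N}|x_j-x_k|\prod_{j=1}^N w(x_j)\,(1+f(x_j))\,dx_j}{\int_{[-1,1]^N}\prod_{1\le j<k\le N}|x_j-x_k|\prod_{j=1}^N w(x_j)\,dx_j}.$$ For $j\ge 0$ let $P_j^{(a+1,b+1)}$ be the Jacobi polynomials (in the standard normalization), let $h_j^{(a+1,b+1)}=\int_{-1}^1 P_j^{(a+1,b+1)}(x)^2(1-x)^{a+1}(1+x)^{b+1}dx$, and let $$\varphi_j^{(1)}(x)=\frac{P_j^{(a+1,b+1)}(x)}{\sqrt{h_j^{(a+1,b+1)}}}(1-x)^{a/2}(1+x)^{b/2},\qquad S_N^{(1)}(x,y)=\sum_{j=0}^{N-1}(1-x^2)\varphi_j^{(1)}(x)\varphi_j^{(1)}(y),$$ $$C_N^{(1)}=\sqrt{\frac{N(N+a+1)(N+b+1)(N+a+b+2)}{(2N+a+b+1)(2N+a+b+3)}},\qquad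 \varepsilon(x,y)=\tfrac12\,\mathrm{sgn}(x-y).$$ Write $S_N^{(1)}$ and $\varepsilon$ also for the integral operators on $[-1,1]$ with these kernels, $u\otimes v$ for the operator with kernel $u(x)v(y)$, and a function for the operator of multiplication by it; products of operators are compositions, and composition on the right with a product of operators acts on the whole rank-one operator $u\otimes v$. Define $$\begin{aligned}T_{\mathrm{JOE}}={}&S_N^{(1)}(f^2+2f)-S_N^{(1)}\varepsilon f'-S_N^{(1)}f\varepsilon f'+C_N^{(1)}\big(\varepsilon\varphi_N^{(1)}\big)\otimes\varphi_{N-1}^{(1)}\,(f^2+2f)\\&+C_N^{(1)}\big(\varepsilon\varphi_N^{(1)}\big)\otimes\big(\varepsilon\varphi_{N-1}^{(1)}\big)\,f'-C_N^{(1)}\big(\varepsilon\varphi_N^{(1)}\big)\otimes\varphi_{N-1}^{(1)}\,f\varepsilon f'.\end{aligned}$$ Then the Fredholm series of the kernel of $T_{\mathrm{JOE}}$ converges absolutely, and $$\big[G_N^{(1)}(f)\big]^2=\det(I+T_{\mathrm{JOE}}),$$ where $\det(I+T)=\sum_{n\ge0}\frac1{n!}\int_{[-1,1]^n}\det\big[T(x_i,x_j)\big]_{i,j=1}^n\,dx_1\cdots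 dx_n$ is the Fredholm determinant. -/

import Mathlib

open MeasureTheory

noncomputable section

namespace JacobiEnsemble

/-- The interval `[-1, 1]`. -/
def J : Set ℝ := Set.Icc (-1) 1

/-- The cube `[-1, 1]^n`. -/
def cube (n : ℕ) : Set (Fin n → ℝ) := Set.univ.pi fun _ => J

/-- The Jacobi polynomial `P_n^{(α,β)}`, in the standard normalization
`P_n^{(α,β)}(1) = (α+1)(α+2)⋯(α+n) / n!`, that is
`P_n^{(α,β)}(x) = ∑_{k=0}^n (n+α+β+1)_k (α+k+1)_{n-k} / (k! (n-k)!) ((x-1)/2)^k`,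
where `(c)_k = c(c+1)⋯(c+k-1)`. -/
def jacobiP (α β : ℝ) (n : ℕ) : Polynomial ℝ :=
  ∑ k ∈ Finset.range (n + 1),
    Polynomial.C ((ascPochhammer ℝ k).eval ((n : ℝ) + α + β + 1) *
        (ascPochhammer ℝ (n - k)).eval (α + (k : ℝ) + 1) /
        ((k.factorial : ℝ) * ((n - k).factorial : ℝ))) *
      (Polynomial.C (1 / 2 : ℝ) * (Polynomial.X - 1)) ^ k

/-- The squared norm `h_n^{(α,β)} = ∫_{-1}^1 P_n^{(α,β)}(x)² (1-x)^α (1+x)^β dx`. -/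
def jacobiH (α β : ℝ) (n : ℕ) : ℝ :=
  ∫ x in J, ((jacobiP α β n).eval x) ^ 2 * ((1 - x) ^ α * (1 + x) ^ β)

/-- The weight `w(x) = (1-x)^{a/2} (1+x)^{b/2}` of the Jacobi orthogonal ensemble. -/
def weight (a b : ℝ) (x : ℝ) : ℝ := (1 - x) ^ (a / 2) * (1 + x) ^ (b / 2)

/-- The generating function
`G_N^{(β)}(f) = ∫ ∏_{j<k} |x_j - x_k|^β ∏_j w(x_j) (1 + f(x_j)) dx / ∫ ∏_{j<k} |x_j - x_k|^β ∏_j w(x_j) dx`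
over `[-1, 1]^N`, for a weight `w` on `[-1, 1]`. -/
def G (β : ℕ) (w : ℝ → ℝ) (N : ℕ) (f : ℝ → ℂ) : ℂ :=
  (∫ x in cube N, ((∏ j : Fin N, ∏ k ∈ Finset.Ioi j, |x j - x k| ^ β : ℝ) : ℂ) *
      ∏ j : Fin N, ((w (x j) : ℂ) * (1 + f (x j)))) /
  (∫ x in cube N, ((∏ j : Fin N, ∏ k ∈ Finset.Ioi j, |x j - x k| ^ β : ℝ) : ℂ) *
      ∏ j : Fin N, (w (x j) : ℂ))

/-! Integral operators on `[-1, 1]`, represented by their kernels `K x y`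
(the operator is `g ↦ ∫_{-1}^1 K x y g(y) dy`). -/

/-- The kernel of the composition `K L` of two integral operators. -/
def comp (K L : ℝ → ℝ → ℂ) : ℝ → ℝ → ℂ := fun x y => ∫ z in J, K x z * L z y

/-- The kernel of the composition `K f` of an integral operator `K` with the operator of
multiplication by the function `f` (which acts first). -/
def mulRight (K : ℝ → ℝ → ℂ) (f : ℝ → ℂ) : ℝ → ℝ → ℂ := fun x y => K x y * f y

/-- The kernel `u(x) v(y)` of the rank-one operator `u ⊗ v`. -/
def tensor (u v : ℝ → ℂ) : ℝ → ℝ → ℂ := fun x y => u x * v y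

/-- The integral operator with kernel `K` applied to the function `g`. -/
def applyFun (K : ℝ → ℝ → ℂ) (g : ℝ → ℂ) : ℝ → ℂ := fun x => ∫ y in J, K x y * g y

/-- The kernel `ε(x,y) = sgn(x-y) / 2`. -/
def eps : ℝ → ℝ → ℂ := fun x y => ((Real.sign (x - y) / 2 : ℝ) : ℂ)

/-- The `n`-th term of the Fredholm series of `det (I + K)`,
`(1/n!) ∫_{[-1,1]^n} det [K(x_i, x_j)]_{i,j=1}^n dx_1 ⋯ dx_n`. -/
def fredholmTerm (K : ℝ → ℝ → ℂ) (n : ℕ) : ℂ :=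
  (1 / (n.factorial : ℂ)) *
    ∫ x in cube n, Matrix.det (Matrix.of fun i j : Fin n => K (x i) (x j))

/-- The Fredholm determinant `det (I + K)` of the integral operator on `[-1, 1]`
with kernel `K`. -/
def fredholmDet (K : ℝ → ℝ → ℂ) : ℂ := ∑' n : ℕ, fredholmTerm K n

/-- `φ_j(x) = P_j^{(a+1,b+1)}(x) / √h_j^{(a+1,b+1)} · (1-x)^{a/2} (1+x)^{b/2}`. -/
def phi (a b : ℝ) (j : ℕ) : ℝ → ℂ := fun x =>
  (((jacobiP (a + 1) (b + 1) j).eval x / √(jacobiH (a + 1) (b + 1) j) * weight a b x : ℝ) : ℂ)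

/-- `S_N(x,y) = ∑_{j=0}^{N-1} (1-x²) φ_j(x) φ_j(y)`. -/
def S (a b : ℝ) (N : ℕ) : ℝ → ℝ → ℂ := fun x y =>
  ∑ j ∈ Finset.range N, (1 - (x : ℂ) ^ 2) * phi a b j x * phi a b j y

/-- `C_N = √( N(N+a+1)(N+b+1)(N+a+b+2) / ((2N+a+b+1)(2N+a+b+3)) )`. -/
def C (a b : ℝ) (N : ℕ) : ℝ :=
  √((N : ℝ) * (N + a + 1) * (N + b + 1) * (N + a + b + 2) /
    ((2 * N + a + b + 1) * (2 * N + a + b + 3)))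

/-- The kernel of the operator
`S_N (f²+2f) - S_N ε f' - S_N f ε f' + C_N (εφ_N) ⊗ φ_{N-1} (f²+2f)
  + C_N (εφ_N) ⊗ (εφ_{N-1}) f' - C_N (εφ_N) ⊗ φ_{N-1} f ε f'`,
where products are compositions of operators, functions act by multiplication, and
`f'` is the derivative of `f` on `[-1, 1]` (one-sided at the endpoints). -/
def T (a b : ℝ) (N : ℕ) (f : ℝ → ℂ) : ℝ → ℝ → ℂ :=
  let f' : ℝ → ℂ := derivWithin f J
  let q : ℝ → ℂ := fun x => f x ^ 2 + 2 * f x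
  let c : ℂ := (C a b N : ℂ)
  let u : ℝ → ℂ := applyFun eps (phi a b N)
  let v : ℝ → ℂ := phi a b (N - 1)
  mulRight (S a b N) q
    - comp (S a b N) (mulRight eps f')
    - comp (mulRight (S a b N) f) (mulRight eps f')
    + c • mulRight (tensor u v) q
    + c • mulRight (tensor u (applyFun eps v)) f'
    - c • comp (mulRight (tensor u v) f) (mulRight eps f')

end JacobiEnsemble

end

/-! Write ⟨g,h⟩ = ∫∫ g(x) ε(x,y) h(y) dx dy over [-1,1]² and let A_f be the N×N matrix with entries
⟨φ_i(1+f), φ_j(1+f)⟩ (`skewMoment`). The plan is to show that both sides of the formula equal det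
A_f / det A_0.

For the left side, ∏|x_j - x_k| is the Vandermonde determinant times the Pfaffian of ε(x_j, x_k), up
to a nonzero constant: both factors change by the same sign when the points are sorted. De Bruijn's
formula then integrates determinant times Pfaffian to a Pfaffian of skew moments, and the square of
a Pfaffian is a determinant. Hence the squared numerator of G_N is c · det A_f with c ≠ 0
independent of f (`partition_sq`), and c cancels in the quotient.

For the right side, the kernel T is a sum of N products r_k(x) l_k(y) (`T_eq_sum`), so its Fredholm
series is finite and equals det(1 + M) with M_ik = ∫ l_i r_k (`fredholmDet_of_finite_rank`).

The link is differentiation. The Jacobi recurrences and norms give ((1-x²)φ_k)' = -d_k φ_{k+1} +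
d_{k-1} φ_{k-1}, a skew tridiagonal action. Let D be its truncation to indices below N
(`skewMatrix`). Since ε inverts d/dx on functions vanishing at ±1, it sends ∑_j D_jk φ_j to r_k,
which is (1-x²)φ_k plus, for k = N-1 only, the truncation term d_{N-1} εφ_N, where d_{N-1} = C_N.
The φ_i are biorthogonal to the (1-x²)φ_k, so A_0 D is the identity up to an error in the last
column; skew-symmetry of A_0 and D forces that error to vanish (`mul_eq_one_of_skew`).

Finally, commuting ε past 1+f by parts, with f(±1) = 0, gives ⟨φ(1+f), g(1+f)⟩ = ⟨φ,g⟩ + ∫ l · εg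
(`skewForm_one_add_mul`). Thus A_f D = A_0 D + M = 1 + M, and taking determinants with det A_0 · det
D = 1 finishes the proof. -/

namespace Matrix

/-! ### Pfaffians as permutation sums, and their squares. -/

open Equiv Finset

variable {ι R : Type*} [Fintype ι] [DecidableEq ι] [CommRing R]

/-- The sum `∑_σ sgn σ ∏_i A_{σ(inl i), σ(inr i)}`, which is `2 ^ m * m !` times the Pfaffian when
`A` is a skew-symmetric matrix of size `2 * m`. -/
def pfaffianSum (A : Matrix (ι ⊕ ι) (ι ⊕ ι) R) : R :=
  ∑ σ : Perm (ι ⊕ ι), ((Perm.sign σ : ℤ) : R) * ∏ i, A (σ (Sum.inl i)) (σ (Sum.inr i))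

/-- A column selection with a repetition has zero determinant, so only permutations survive, each
contributing its sign. -/
lemma sum_det_submatrix_mul {n : Type*} [Fintype n] [DecidableEq n] (B : Matrix n n R)
    (F : (n → n) → R) :
    ∑ f : n → n, det (B.submatrix id f) * F f =
      det B * ∑ σ : Perm n, ((Perm.sign σ : ℤ) : R) * F σ := by
  classical
  have hzero : ∀ f : n → n, ¬ Function.Injective f → det (B.submatrix id f) = 0 := by
    intro f hf
    obtain ⟨i, j, hij, hne⟩ : ∃ i j, f i = f j ∧ i ≠ j := by
      simpa [Function.Injective] using hf
    exact det_zero_of_column_eq hne fun k => by simp [hij]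
  rw [mul_sum]
  have h1 : ∑ f : n → n, det (B.submatrix id f) * F f =
      ∑ f ∈ univ.filter (fun f : n → n => Function.Bijective f), det (B.submatrix id f) * F f := by
    symm
    refine sum_subset (filter_subset _ _) fun f _ hf => ?_
    rw [hzero f, zero_mul]
    intro hinj
    exact hf (by simpa using Finite.injective_iff_bijective.mp hinj)
  rw [h1]
  refine sum_bij' (fun f hf => Equiv.ofBijective f (by simpa using hf)) (fun σ _ => σ)
    (by simp) (fun σ _ => by simp) (by intros; rfl)
    (by intros; ext; rfl) ?_
  intro f hf
  have := det_permute' (Equiv.ofBijective f (by simpa using hf)) B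
  rw [← mul_assoc, mul_comm (det B)]
  congr 1

/-- Expanding every entry of B A Bᵀ turns the sum over σ into determinants of column selections of
B, to which `sum_det_submatrix_mul` applies. Skew-symmetry plays no role. -/
lemma pfaffianSum_mul_mul_transpose (A B : Matrix (ι ⊕ ι) (ι ⊕ ι) R) :
    pfaffianSum (B * A * Bᵀ) = det B * pfaffianSum A := by
  have hent : ∀ a b, (B * A * Bᵀ) a b =
      ∑ p : (ι ⊕ ι) × (ι ⊕ ι), B a p.1 * B b p.2 * A p.1 p.2 := by
    intro a b
    rw [Fintype.sum_prod_type_right, mul_apply]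
    refine sum_congr rfl fun y _ => ?_
    rw [mul_apply, sum_mul]
    exact sum_congr rfl fun x _ => by rw [transpose_apply]; ring
  let e : (ι → (ι ⊕ ι) × (ι ⊕ ι)) ≃ (ι ⊕ ι → ι ⊕ ι) :=
    (Equiv.arrowProdEquivProdArrow ι _ _).trans (Equiv.sumArrowEquivProdArrow ι ι _).symm
  have hprod : ∀ σ : Perm (ι ⊕ ι), ∏ i, (B * A * Bᵀ) (σ (Sum.inl i)) (σ (Sum.inr i)) =
      ∑ f : ι ⊕ ι → ι ⊕ ι, (∏ a, B (σ a) (f a)) * ∏ i, A (f (Sum.inl i)) (f (Sum.inr i)) := by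
    intro σ
    simp_rw [hent]
    rw [Finset.prod_univ_sum, ← e.sum_comp, Fintype.piFinset_univ]
    refine sum_congr rfl fun F _ => ?_
    rw [Fintype.prod_sum_type, ← prod_mul_distrib, ← prod_mul_distrib]
    rfl
  unfold pfaffianSum
  rw [← sum_det_submatrix_mul B fun f => ∏ i, A (f (Sum.inl i)) (f (Sum.inr i))]
  simp_rw [hprod, mul_sum, det_apply', sum_mul]
  rw [sum_comm]
  refine sum_congr rfl fun f _ => sum_congr rfl fun σ _ => ?_
  simp [mul_assoc]

lemma pfaffianSum_submatrix (A : Matrix (ι ⊕ ι) (ι ⊕ ι) R) (s : Perm (ι ⊕ ι)) :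
    pfaffianSum (A.submatrix s s) = ((Perm.sign s : ℤ) : R) * pfaffianSum A := by
  unfold pfaffianSum
  rw [mul_sum, ← Equiv.sum_comp (Equiv.mulLeft s⁻¹)]
  refine sum_congr rfl fun σ _ => ?_
  simp only [Equiv.coe_mulLeft, Perm.sign_mul, Perm.sign_inv, submatrix_apply, Perm.mul_apply]
  simp only [Perm.inv_def, apply_symm_apply]
  push_cast
  ring

/-- After expanding the product, a term using S at some pair changes sign when the two members of
that pair are exchanged. So only the skew part of a matrix is seen, which allows it to be replaced
by a simpler one. -/
lemma pfaffianSum_add_of_isSymm (A S : Matrix (ι ⊕ ι) (ι ⊕ ι) R) (hS : S.IsSymm)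
    (h2 : ∀ r : R, r + r = 0 → r = 0) :
    pfaffianSum (A + S) = pfaffianSum A := by
  classical
  have key : ∀ t : Finset ι, t ≠ univ →
      ∑ σ : Perm (ι ⊕ ι), ((Perm.sign σ : ℤ) : R) *
        ((∏ i ∈ t, A (σ (Sum.inl i)) (σ (Sum.inr i))) *
          ∏ i ∈ univ \ t, S (σ (Sum.inl i)) (σ (Sum.inr i))) = 0 := by
    intro t ht
    obtain ⟨i₀, hi₀⟩ : ∃ i₀, i₀ ∉ t := by
      by_contra! h
      exact ht (eq_univ_iff_forall.mpr h)
    apply h2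
    nth_rewrite 1 [← Equiv.sum_comp (Equiv.mulRight (Equiv.swap (Sum.inl i₀) (Sum.inr i₀) : Perm (ι ⊕ ι)))]
    rw [← sum_add_distrib]
    refine sum_eq_zero fun σ _ => ?_
    have hsw : ∀ i, i ≠ i₀ → (Equiv.swap (Sum.inl i₀) (Sum.inr i₀) : Perm (ι ⊕ ι)) (Sum.inl i) = Sum.inl i ∧
        (Equiv.swap (Sum.inl i₀) (Sum.inr i₀) : Perm (ι ⊕ ι)) (Sum.inr i) = Sum.inr i := fun i hi =>
      ⟨swap_apply_of_ne_of_ne (by simpa using hi) (by simp),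
        swap_apply_of_ne_of_ne (by simp) (by simpa using hi)⟩
    have e1 : ∏ i ∈ t, A ((σ * (Equiv.swap (Sum.inl i₀) (Sum.inr i₀) : Perm (ι ⊕ ι))) (Sum.inl i))
          ((σ * (Equiv.swap (Sum.inl i₀) (Sum.inr i₀) : Perm (ι ⊕ ι))) (Sum.inr i)) =
        ∏ i ∈ t, A (σ (Sum.inl i)) (σ (Sum.inr i)) := by
      refine prod_congr rfl fun i hi => ?_
      have := hsw i (fun h => hi₀ (h ▸ hi))
      rw [Perm.mul_apply, Perm.mul_apply, this.1, this.2]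
    have e2 : ∏ i ∈ univ \ t, S ((σ * (Equiv.swap (Sum.inl i₀) (Sum.inr i₀) : Perm (ι ⊕ ι))) (Sum.inl i))
          ((σ * (Equiv.swap (Sum.inl i₀) (Sum.inr i₀) : Perm (ι ⊕ ι))) (Sum.inr i)) =
        ∏ i ∈ univ \ t, S (σ (Sum.inl i)) (σ (Sum.inr i)) := by
      refine prod_congr rfl fun i _ => ?_
      by_cases h : i = i₀
      · subst h
        rw [Perm.mul_apply, Perm.mul_apply, swap_apply_left, swap_apply_right, hS.apply]
      · have := hsw i h
        rw [Perm.mul_apply, Perm.mul_apply, this.1, this.2]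
    rw [Equiv.coe_mulRight, e1, e2, Perm.sign_mul, Perm.sign_swap (by simp)]
    push_cast
    ring
  unfold pfaffianSum
  simp_rw [add_apply, Finset.prod_add, mul_sum]
  rw [sum_comm, sum_eq_single univ]
  · simp
  · intro t _ ht
    exact key t ht
  · simp

/-- The surviving permutations act by the same τ on both copies of ι, so their sign is (sgn τ)² = 1
and nothing cancels. -/
lemma pfaffianSum_fromBlocks_zero_one_zero_zero :
    ∃ k : ℕ, k ≠ 0 ∧ pfaffianSum (fromBlocks 0 1 0 0 : Matrix (ι ⊕ ι) (ι ⊕ ι) R) = k := by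
  classical
  let good : Finset (Perm (ι ⊕ ι)) := univ.filter fun σ => ∃ τ : Perm ι, σ = Perm.sumCongr τ τ
  refine ⟨good.card, ?_, ?_⟩
  · refine Finset.card_ne_zero_of_mem (a := 1) ?_
    simp only [good, mem_filter, mem_univ, true_and]
    exact ⟨1, by simp⟩
  · have hterm : ∀ σ : Perm (ι ⊕ ι), ((Perm.sign σ : ℤ) : R) *
        ∏ i, (fromBlocks 0 1 0 0 : Matrix (ι ⊕ ι) (ι ⊕ ι) R) (σ (Sum.inl i)) (σ (Sum.inr i)) =
        if σ ∈ good then 1 else 0 := by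
      intro σ
      split_ifs with h
      · obtain ⟨τ, rfl⟩ : ∃ τ : Perm ι, σ = Perm.sumCongr τ τ := by simpa [good] using h
        simp [Int.units_mul_self]
      · by_contra hne
        apply h
        have hall : ∀ i, ∃ j, σ (Sum.inl i) = Sum.inl j ∧ σ (Sum.inr i) = Sum.inr j := by
          intro i
          have hi : (fromBlocks 0 1 0 0 : Matrix (ι ⊕ ι) (ι ⊕ ι) R)
              (σ (Sum.inl i)) (σ (Sum.inr i)) ≠ 0 := by
            intro h0
            exact hne (by rw [prod_eq_zero (mem_univ i) h0, mul_zero])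
          rcases hl : σ (Sum.inl i) with j | j <;> rcases hr : σ (Sum.inr i) with k | k <;>
            rw [hl, hr] at hi
          · simp at hi
          · refine ⟨j, rfl, ?_⟩
            by_contra hjk
            exact hi (by simp only [fromBlocks_apply₁₂]; exact one_apply_ne fun h => hjk (by rw [h]))
          · simp at hi
          · simp at hi
        choose τ hτ using hall
        have hinj : Function.Injective τ := fun i j hij => by
          have : σ (Sum.inl i) = σ (Sum.inl j) := by rw [(hτ i).1, (hτ j).1, hij]
          simpa using this
        simp only [good, mem_filter, mem_univ, true_and]
        refine ⟨Equiv.ofBijective τ (Finite.injective_iff_bijective.mp hinj), ?_⟩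
        ext (i | i)
        · simp [(hτ i).1]
        · simp [(hτ i).2]
    unfold pfaffianSum
    simp_rw [hterm]
    simp

variable {K : Type*} [Field K]

/-- The standard skew-symmetric matrix with `e_i, f_j` paired to `δ_ij`. -/
abbrev stdSkew (ι K : Type*) [DecidableEq ι] [Field K] : Matrix (ι ⊕ ι) (ι ⊕ ι) K :=
  fromBlocks 0 1 (-1) 0

lemma pfaffianSum_stdSkew_ne_zero [CharZero K] : pfaffianSum (stdSkew ι K) ≠ 0 := by
  have h2 : ∀ r : K, r + r = 0 → r = 0 := fun r hr => by
    rw [← two_mul] at hr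
    simpa using hr
  -- Modulo symmetric matrices, the standard skew matrix is twice its upper right block.
  have hJ : stdSkew ι K = (2 : K) • (fromBlocks 0 1 0 0 : Matrix (ι ⊕ ι) (ι ⊕ ι) K) +
      fromBlocks 0 (-1) (-1) 0 := by
    rw [fromBlocks_smul, fromBlocks_add]
    simp [two_smul]
  obtain ⟨k, hk, hk'⟩ := pfaffianSum_fromBlocks_zero_one_zero_zero (ι := ι) (R := K)
  rw [hJ, pfaffianSum_add_of_isSymm _ _ _ h2]
  · have : pfaffianSum ((2 : K) • (fromBlocks 0 1 0 0 : Matrix (ι ⊕ ι) (ι ⊕ ι) K)) =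
        2 ^ Fintype.card ι * k := by
      rw [← hk']
      unfold pfaffianSum
      simp_rw [smul_apply, smul_eq_mul, prod_mul_distrib]
      rw [mul_sum]
      refine sum_congr rfl fun σ _ => ?_
      simp
      ring
    rw [this]
    exact mul_ne_zero (pow_ne_zero _ two_ne_zero) (Nat.cast_ne_zero.mpr hk)
  · simp [IsSymm, fromBlocks_transpose]

lemma det_stdSkew : det (stdSkew ι K) = 1 := by
  have h : stdSkew ι K = fromBlocks 1 1 0 1 * fromBlocks 1 0 (-1) 1 * fromBlocks 1 1 0 1 := by
    simp [stdSkew, fromBlocks_multiply]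
  rw [h, det_mul, det_mul, det_fromBlocks_zero₂₁, det_fromBlocks_zero₁₂]
  simp

/-- Symplectic families of size `2 * n` exist for a nondegenerate alternating form, as long as they
fit into the space. -/
lemma exists_symplectic_family [CharZero K] {V : Type*} [AddCommGroup V] [Module K V] [FiniteDimensional K V]
    (B : V →ₗ[K] V →ₗ[K] K) (hB : ∀ x y, B x y = -B y x)
    (hnd : ∀ x, (∀ y, B x y = 0) → x = 0) (n : ℕ) (hn : n + n ≤ Module.finrank K V) :
    ∃ e f : Fin n → V, (∀ i j, B (e i) (e j) = 0) ∧ (∀ i j, B (f i) (f j) = 0) ∧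
      ∀ i j, B (e i) (f j) = if i = j then 1 else 0 := by
  induction n with
  | zero => exact ⟨Fin.elim0, Fin.elim0, fun i => i.elim0, fun i => i.elim0, fun i => i.elim0⟩
  | succ n ih =>
    obtain ⟨e, f, hee, hff, hef⟩ := ih (by omega)
    have hself : ∀ x, B x x = 0 := fun x => by
      have := hB x x
      have h2 : (2 : K) * B x x = 0 := by linear_combination this
      simpa using h2
    have hfe : ∀ i j, B (f i) (e j) = if i = j then -1 else 0 := fun i j => by
      rw [hB, hef]
      by_cases h : i = j
      · simp [h]
      · simp [h, Ne.symm h]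
    -- Projection onto the B-orthogonal complement of the family found so far; the next symplectic
    -- pair is taken there.
    obtain ⟨pr, hpr⟩ : ∃ pr : V → V,
        ∀ w, pr w = w - ∑ i, B w (f i) • e i + ∑ i, B w (e i) • f i := ⟨_, fun _ => rfl⟩
    have hpre : ∀ w j, B (pr w) (e j) = 0 := fun w j => by
      simp [hpr, hee, hfe]
    have hprf : ∀ w j, B (pr w) (f j) = 0 := fun w j => by
      simp [hpr, hff, hef]
    have hspan : Submodule.span K (Set.range (Sum.elim e f)) ≠ ⊤ := by
      intro htop
      have h1 := finrank_range_le_card (R := K) (Sum.elim e f)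
      rw [Set.finrank, htop, finrank_top] at h1
      simp at h1
      omega
    obtain ⟨w, hw⟩ : ∃ w, w ∉ Submodule.span K (Set.range (Sum.elim e f)) := by
      by_contra! h
      exact hspan (Submodule.eq_top_iff'.mpr h)
    have hw0 : pr w ≠ 0 := by
      intro h0
      apply hw
      have : w = ∑ i, B w (f i) • e i - ∑ i, B w (e i) • f i := by
        have h0' : w - ∑ i, B w (f i) • e i + ∑ i, B w (e i) • f i = 0 := by
          rw [← hpr, h0]
        rw [← sub_eq_zero, ← h0']
        abel
      rw [this]
      refine Submodule.sub_mem _ ?_ ?_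
      · exact Submodule.sum_mem _ fun i _ => Submodule.smul_mem _ _
          (Submodule.subset_span ⟨Sum.inl i, rfl⟩)
      · exact Submodule.sum_mem _ fun i _ => Submodule.smul_mem _ _
          (Submodule.subset_span ⟨Sum.inr i, rfl⟩)
    obtain ⟨y, hy⟩ : ∃ y, B (pr w) y ≠ 0 := by
      by_contra! h
      exact hw0 (hnd _ h)
    set u := (B (pr w) y)⁻¹ • y with hu
    have hwu : B (pr w) (pr u) = 1 := by
      -- `pr w` is already orthogonal to the old family, so projecting the second argument does not
      -- change the pairing.
      have : B (pr w) (pr u) = B (pr w) u := by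
        rw [hpr u]
        simp [hpre, hprf]
      rw [this, hu]
      simp [hy]
    have hswap : ∀ x z, B x z = 0 → B z x = 0 := fun x z h => by rw [hB, h, neg_zero]
    refine ⟨Fin.cons (pr w) e, Fin.cons (pr u) f, ?_, ?_, ?_⟩
    · intro i j
      refine Fin.cases ?_ (fun i => ?_) i <;> refine Fin.cases ?_ (fun j => ?_) j <;>
        simp only [Fin.cons_zero, Fin.cons_succ]
      · exact hself _
      · exact hpre _ _
      · exact hswap _ _ (hpre _ _)
      · exact hee _ _
    · intro i j
      refine Fin.cases ?_ (fun i => ?_) i <;> refine Fin.cases ?_ (fun j => ?_) j <;>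
        simp only [Fin.cons_zero, Fin.cons_succ]
      · exact hself _
      · exact hprf _ _
      · exact hswap _ _ (hprf _ _)
      · exact hff _ _
    · intro i j
      refine Fin.cases ?_ (fun i => ?_) i <;> refine Fin.cases ?_ (fun j => ?_) j <;>
        simp only [Fin.cons_zero, Fin.cons_succ]
      · simpa using hwu
      · rw [hprf]; simp [Fin.ext_iff]
      · rw [hswap _ _ (hpre _ _)]; simp [Fin.ext_iff]
      · simp [hef]

/-- Put a kernel vector v in row a of the identity matrix to form B, with v a ≠ 0. Row and column a
of B A Bᵀ vanish, and every term of the sum meets one of them. -/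
lemma pfaffianSum_eq_zero_of_det_eq_zero (A : Matrix (ι ⊕ ι) (ι ⊕ ι) K) (hA : Aᵀ = -A)
    (hdet : det A = 0) : pfaffianSum A = 0 := by
  obtain ⟨v, hv, hvA⟩ := exists_vecMul_eq_zero_iff.mpr hdet
  obtain ⟨a, ha⟩ : ∃ a, v a ≠ 0 := by
    by_contra! h
    exact hv (funext h)
  let B : Matrix (ι ⊕ ι) (ι ⊕ ι) K := updateRow 1 a v
  have hB : det B = v a := by
    have : v = ∑ j, v j • (1 : Matrix (ι ⊕ ι) (ι ⊕ ι) K) j := by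
      ext k
      simp [Finset.sum_apply, one_apply]
    have h2 := det_updateRow_sum (1 : Matrix (ι ⊕ ι) (ι ⊕ ι) K) a v
    rw [← this] at h2
    simpa using h2
  have hrow : ∀ b, (B * A * Bᵀ) a b = 0 := by
    intro b
    have : (B * A) a = 0 := by
      rw [mul_apply_eq_vecMul]
      simp [B, hvA]
    rw [mul_apply]
    refine sum_eq_zero fun c _ => ?_
    rw [show (B * A) a c = 0 from congrFun this c, zero_mul]
  have hskew : (B * A * Bᵀ)ᵀ = -(B * A * Bᵀ) := by
    simp [transpose_mul, hA, mul_assoc]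
  have hcol : ∀ b, (B * A * Bᵀ) b a = 0 := by
    intro b
    have := congrFun (congrFun hskew a) b
    rw [transpose_apply, neg_apply, hrow, neg_zero] at this
    exact this
  have hz : pfaffianSum (B * A * Bᵀ) = 0 := by
    unfold pfaffianSum
    refine sum_eq_zero fun σ _ => ?_
    rcases h : σ.symm a with i | i
    · have h' : σ (Sum.inl i) = a := by rw [← h, apply_symm_apply]
      rw [prod_eq_zero (mem_univ i) (by rw [h', hrow]), mul_zero]
    · have h' : σ (Sum.inr i) = a := by rw [← h, apply_symm_apply]
      rw [prod_eq_zero (mem_univ i) (by rw [h', hcol]), mul_zero]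
  rw [pfaffianSum_mul_mul_transpose, hB] at hz
  exact (mul_eq_zero.mp hz).resolve_left ha

/-- The square of the Pfaffian is the determinant. -/
theorem pfaffianSum_sq [CharZero K] {m : ℕ} (A : Matrix (Fin m ⊕ Fin m) (Fin m ⊕ Fin m) K) (hA : Aᵀ = -A) :
    pfaffianSum A ^ 2 = pfaffianSum (stdSkew (Fin m) K) ^ 2 * det A := by
  by_cases hdet : det A = 0
  · rw [pfaffianSum_eq_zero_of_det_eq_zero A hA hdet, hdet]
    simp
  let B : (Fin m ⊕ Fin m → K) →ₗ[K] (Fin m ⊕ Fin m → K) →ₗ[K] K := Matrix.toLinearMap₂' K A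
  have hBapp : ∀ x y, B x y = x ⬝ᵥ (A *ᵥ y) := fun x y => Matrix.toLinearMap₂'_apply' A x y
  obtain ⟨e, f, hee, hff, hef⟩ := exists_symplectic_family B
    (fun x y => by
      rw [hBapp, hBapp, dotProduct_mulVec, ← mulVec_transpose, hA, neg_mulVec, neg_dotProduct,
        dotProduct_comm])
    (fun x hx => by
      have h0 : x ᵥ* A = 0 := by
        ext j
        have := hx (Pi.single j 1)
        rw [hBapp, dotProduct_mulVec] at this
        simpa using this
      by_contra hne
      exact hdet (exists_vecMul_eq_zero_iff.mp ⟨x, hne, h0⟩))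
    m (by simp)
  let M : Matrix (Fin m ⊕ Fin m) (Fin m ⊕ Fin m) K := Matrix.of (Sum.elim e f)
  have hM : M * A * Mᵀ = stdSkew (Fin m) K := by
    have hent : ∀ a b, (M * A * Mᵀ) a b = B (M a) (M b) := fun a b => by
      rw [hBapp, dotProduct_mulVec, mul_apply_eq_vecMul, mul_apply_eq_vecMul, vecMul_transpose]
      simp [mulVec, dotProduct_comm]
    have hBs : ∀ x y, B x y = -B y x := fun x y => by
      rw [hBapp, hBapp, dotProduct_mulVec, ← mulVec_transpose, hA, neg_mulVec, neg_dotProduct,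
        dotProduct_comm]
    have hMl : ∀ i, M (Sum.inl i) = e i := fun _ => rfl
    have hMr : ∀ i, M (Sum.inr i) = f i := fun _ => rfl
    ext (i | i) (j | j) <;> rw [hent]
    · rw [hMl, hMl, hee]
      rfl
    · rw [hMl, hMr, hef, ← one_apply]
      rfl
    · rw [hMl, hMr, hBs, hef, show (if j = i then (1 : K) else 0) = if i = j then 1 else 0 by
        simp only [eq_comm], ← one_apply]
      rfl
    · rw [hMr, hMr, hff]
      rfl
  -- The rows of M form a symplectic basis. With J the standard matrix, Pf J = det M · Pf A and 1 =
  -- det J = (det M)² det A; eliminate det M.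
  have h1 := pfaffianSum_mul_mul_transpose A M
  have h2 : det (M * A * Mᵀ) = det M ^ 2 * det A := by
    rw [det_mul, det_mul, det_transpose]
    ring
  rw [hM] at h1 h2
  rw [det_stdSkew] at h2
  rw [h1]
  linear_combination (pfaffianSum A ^ 2) * h2

end Matrix

/-! ### De Bruijn's integration formula. -/

namespace MeasureTheory

variable {X : Type*} [MeasurableSpace X] (μ : Measure X) [SigmaFinite μ]

lemma measurePreserving_comp_equiv {α β : Type*} [Fintype α] [Fintype β] (e : β ≃ α) :
    MeasurePreserving (MeasurableEquiv.piCongrLeft (fun _ : β => X) e.symm)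
      (Measure.pi fun _ : α => μ) (Measure.pi fun _ : β => μ) :=
  measurePreserving_piCongrLeft (fun _ : β => μ) e.symm

lemma piCongrLeft_symm_eq_comp {α β : Type*} (e : β ≃ α) (x : α → X) :
    MeasurableEquiv.piCongrLeft (fun _ : β => X) e.symm x = x ∘ e := by
  ext b
  obtain ⟨a, rfl⟩ := e.symm.surjective b
  rw [MeasurableEquiv.coe_piCongrLeft, Equiv.piCongrLeft_apply_apply]
  simp

lemma integral_pi_comp_equiv {α β : Type*} [Fintype α] [Fintype β] (e : β ≃ α)
    (F : (β → X) → ℂ) :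
    ∫ x : α → X, F (x ∘ e) ∂(Measure.pi fun _ => μ) = ∫ y : β → X, F y ∂(Measure.pi fun _ => μ) := by
  rw [← (measurePreserving_comp_equiv μ e).integral_comp' F]
  simp_rw [piCongrLeft_symm_eq_comp]

lemma integrable_pi_comp_equiv {α β : Type*} [Fintype α] [Fintype β] (e : β ≃ α)
    {F : (β → X) → ℂ} (hF : Integrable F (Measure.pi fun _ => μ)) :
    Integrable (fun x : α → X => F (x ∘ e)) (Measure.pi fun _ => μ) := by
  have := ((measurePreserving_comp_equiv μ e).integrable_comp_emb
    (MeasurableEquiv.measurableEmbedding _)).mpr hF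
  refine this.congr (Filter.Eventually.of_forall fun x => ?_)
  simp only [Function.comp_def, piCongrLeft_symm_eq_comp]

/-- Splitting the coordinates indexed by `ι ⊕ ι` into pairs. -/
def pairEquiv (ι X : Type*) [MeasurableSpace X] : (ι ⊕ ι → X) ≃ᵐ (ι → X × X) :=
  (MeasurableEquiv.sumPiEquivProdPi fun _ => X).trans
    (MeasurableEquiv.arrowProdEquivProdArrow X X ι).symm

lemma pairEquiv_apply {ι : Type*} (x : ι ⊕ ι → X) (i : ι) :
    pairEquiv ι X x i = (x (Sum.inl i), x (Sum.inr i)) := rfl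

lemma measurePreserving_pairEquiv (ι : Type*) [Fintype ι] :
    MeasurePreserving (pairEquiv ι X) (Measure.pi fun _ => μ) (Measure.pi fun _ => μ.prod μ) :=
  (measurePreserving_arrowProdEquivProdArrow X X ι (fun _ => μ) (fun _ => μ)).symm.comp
    (measurePreserving_sumPiEquivProdPi fun _ => μ)

lemma integral_prod_pair {ι : Type*} [Fintype ι] (h : ι → X × X → ℂ) :
    ∫ x : ι ⊕ ι → X, ∏ i, h i (x (Sum.inl i), x (Sum.inr i)) ∂(Measure.pi fun _ => μ) =
      ∏ i, ∫ p, h i p ∂(μ.prod μ) := by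
  rw [← integral_fintype_prod_eq_prod, ← (measurePreserving_pairEquiv μ ι).integral_comp']
  simp_rw [pairEquiv_apply]

lemma integrable_prod_pair {ι : Type*} [Fintype ι] {h : ι → X × X → ℂ}
    (hh : ∀ i, Integrable (h i) (μ.prod μ)) :
    Integrable (fun x : ι ⊕ ι → X => ∏ i, h i (x (Sum.inl i), x (Sum.inr i)))
      (Measure.pi fun _ => μ) :=
  ((measurePreserving_pairEquiv μ ι).integrable_comp_emb
    (MeasurableEquiv.measurableEmbedding _)).mpr (Integrable.fintype_prod_dep hh)

/-- De Bruijn's integration formula. -/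
theorem integral_det_mul_pfaffianSum {ι : Type*} [Fintype ι] [DecidableEq ι]
    (g : ι ⊕ ι → X → ℂ) (k : X → X → ℂ)
    (hint : ∀ a b, Integrable (fun p : X × X => g a p.1 * k p.1 p.2 * g b p.2) (μ.prod μ)) :
    ∫ x : ι ⊕ ι → X, Matrix.det (Matrix.of fun a b => g b (x a)) *
        Matrix.pfaffianSum (Matrix.of fun a b => k (x a) (x b)) ∂(Measure.pi fun _ => μ) =
      (Fintype.card (ι ⊕ ι)).factorial *
        Matrix.pfaffianSum (Matrix.of fun a b =>
          ∫ p : X × X, g a p.1 * k p.1 p.2 * g b p.2 ∂(μ.prod μ)) := by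
  let H : Equiv.Perm (ι ⊕ ι) → (ι ⊕ ι → X) → ℂ := fun ρ z =>
    ∏ i, (fun p : X × X => g (ρ (Sum.inl i)) p.1 * k p.1 p.2 * g (ρ (Sum.inr i)) p.2)
      (z (Sum.inl i), z (Sum.inr i))
  have hH : ∀ ρ, Integrable (H ρ) (Measure.pi fun _ => μ) := fun ρ =>
    integrable_prod_pair μ fun i => hint _ _
  have hHint : ∀ ρ, ∫ z, H ρ z ∂(Measure.pi fun _ => μ) =
      ∏ i, ∫ p : X × X, g (ρ (Sum.inl i)) p.1 * k p.1 p.2 * g (ρ (Sum.inr i)) p.2 ∂(μ.prod μ) :=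
    fun ρ => integral_prod_pair μ fun i p =>
      g (ρ (Sum.inl i)) p.1 * k p.1 p.2 * g (ρ (Sum.inr i)) p.2
  have hexp : ∀ x : ι ⊕ ι → X, Matrix.det (Matrix.of fun a b => g b (x a)) *
        Matrix.pfaffianSum (Matrix.of fun a b => k (x a) (x b)) =
      ∑ σ : Equiv.Perm (ι ⊕ ι), ∑ ρ : Equiv.Perm (ι ⊕ ι),
        ((Equiv.Perm.sign ρ : ℤ) : ℂ) * H ρ (x ∘ σ) := by
    intro x
    unfold Matrix.pfaffianSum
    rw [Finset.mul_sum]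
    refine Finset.sum_congr rfl fun σ _ => ?_
    -- Replacing ρ by ρσ⁻¹ in the determinant makes the integrand a function of x ∘ σ, and the two
    -- signs of σ cancel. Each σ then contributes the same integral, whence the factorial.
    rw [← Matrix.det_transpose, Matrix.det_apply', ← Equiv.sum_comp (Equiv.mulRight σ⁻¹),
      Finset.sum_mul]
    refine Finset.sum_congr rfl fun ρ _ => ?_
    have h1 : ∏ a, (Matrix.of fun a b => g b (x a)).transpose ((Equiv.mulRight σ⁻¹ ρ) a) a =
        (∏ i, g (ρ (Sum.inl i)) (x (σ (Sum.inl i)))) *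
          ∏ i, g (ρ (Sum.inr i)) (x (σ (Sum.inr i))) := by
      rw [← Equiv.prod_comp σ, Fintype.prod_sum_type]
      simp
    rw [h1]
    simp only [H, Function.comp_apply, Finset.prod_mul_distrib, Equiv.coe_mulRight,
      Equiv.Perm.sign_mul, Equiv.Perm.sign_inv, Matrix.of_apply]
    have h2 : ((Equiv.Perm.sign σ : ℤ) : ℂ) * ((Equiv.Perm.sign σ : ℤ) : ℂ) = 1 := by
      rw [← Int.cast_mul, ← Units.val_mul, Int.units_mul_self]
      simp
    push_cast
    linear_combination (((Equiv.Perm.sign ρ : ℤ) : ℂ) *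
      (∏ i, g (ρ (Sum.inl i)) (x (σ (Sum.inl i)))) *
      (∏ i, k (x (σ (Sum.inl i))) (x (σ (Sum.inr i)))) *
      (∏ i, g (ρ (Sum.inr i)) (x (σ (Sum.inr i))))) * h2
  simp_rw [hexp]
  have hI : ∀ σ ρ : Equiv.Perm (ι ⊕ ι), Integrable
      (fun x : ι ⊕ ι → X => ((Equiv.Perm.sign ρ : ℤ) : ℂ) * H ρ (x ∘ σ))
      (Measure.pi fun _ => μ) := fun σ ρ =>
    (integrable_pi_comp_equiv μ σ (hH ρ)).const_mul _
  rw [integral_finsetSum _ fun σ _ => integrable_finsetSum _ fun ρ _ => hI σ ρ]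
  have hinner : ∀ σ : Equiv.Perm (ι ⊕ ι), ∫ x : ι ⊕ ι → X, ∑ ρ : Equiv.Perm (ι ⊕ ι),
        ((Equiv.Perm.sign ρ : ℤ) : ℂ) * H ρ (x ∘ σ) ∂(Measure.pi fun _ => μ) =
      Matrix.pfaffianSum (Matrix.of fun a b =>
          ∫ p : X × X, g a p.1 * k p.1 p.2 * g b p.2 ∂(μ.prod μ)) := by
    intro σ
    rw [integral_finsetSum _ fun ρ _ => hI σ ρ]
    unfold Matrix.pfaffianSum
    refine Finset.sum_congr rfl fun ρ _ => ?_
    rw [integral_const_mul, integral_pi_comp_equiv μ σ (H ρ), hHint]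
    rfl
  simp_rw [hinner]
  rw [Finset.sum_const, Finset.card_univ, Fintype.card_perm, nsmul_eq_mul]

end MeasureTheory

/-! ### The sign kernel and the absolute Vandermonde determinant. -/

namespace JacobiEnsemble

lemma eps_swap (x y : ℝ) : eps x y = -eps y x := by
  unfold eps
  rw [← Complex.ofReal_neg, ← neg_sub y x, Real.sign_neg, neg_div]

lemma eps_eq_of_lt {x y : ℝ} (h : x < y) : eps x y = -1 / 2 := by
  unfold eps
  rw [Real.sign_of_neg (by linarith)]
  norm_num

lemma eps_self (x : ℝ) : eps x x = 0 := by
  simp [eps]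

lemma eps_eq_of_gt {x y : ℝ} (h : y < x) : eps x y = 1 / 2 := by
  rw [eps_swap, eps_eq_of_lt h]
  norm_num

lemma norm_eps_le (x y : ℝ) : ‖eps x y‖ ≤ 1 := by
  rcases lt_trichotomy x y with h | h | h
  · rw [eps_eq_of_lt h]
    norm_num
  · rw [h, eps_self]
    norm_num
  · rw [eps_eq_of_gt h]
    norm_num

lemma eps_comp_strictMono {n : ℕ} {z : Fin n → ℝ} (hz : StrictMono z) (i j : Fin n) :
    eps (z i) (z j) = eps (i : ℕ) (j : ℕ) := by
  rcases lt_trichotomy i j with h | h | h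
  · rw [eps_eq_of_lt (hz h), eps_eq_of_lt (by exact_mod_cast h)]
  · rw [h, eps_self, eps_self]
  · rw [eps_eq_of_gt (hz h), eps_eq_of_gt (by exact_mod_cast h)]

lemma measurable_eps : Measurable (fun p : ℝ × ℝ => eps p.1 p.2) := by
  unfold eps
  refine Complex.measurable_ofReal.comp (Measurable.div_const ?_ _)
  have : Measurable Real.sign := by
    unfold Real.sign
    exact Measurable.ite measurableSet_Iio measurable_const
      (Measurable.ite measurableSet_Ioi measurable_const measurable_const)
  exact this.comp (measurable_fst.sub measurable_snd)

/-- The matrix `ε(i, j)` of indices. -/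
noncomputable def epsIndex {κ : Type*} {n : ℕ} (e : κ ≃ Fin n) : Matrix κ κ ℂ :=
  Matrix.of fun a b => eps ((e a : ℕ) : ℝ) ((e b : ℕ) : ℝ)

/-- Twice the matrix is integral and modulo 2 equals the identity plus the all-ones matrix, with
determinant 1 + n, which is odd for n even. -/
lemma det_epsIndex_ne_zero {κ : Type*} [Fintype κ] [DecidableEq κ] {n : ℕ} (e : κ ≃ Fin n)
    (hn : Even n) : Matrix.det (epsIndex e) ≠ 0 := by
  let Z : Matrix κ κ ℤ := Matrix.of fun a b => Int.sign ((e a : ℕ) - (e b : ℕ) : ℤ)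
  have hZ : epsIndex e = (1 / 2 : ℂ) • Z.map (Int.castRingHom ℂ) := by
    ext a b
    simp only [epsIndex, Z, Matrix.of_apply, Matrix.smul_apply, Matrix.map_apply, smul_eq_mul, eps]
    have := Real.sign_intCast ((e a : ℕ) - (e b : ℕ) : ℤ)
    push_cast at this
    rw [this]
    simp
    ring
  have hdetZ : Z.det ≠ 0 := by
    intro h0
    have h1 : (Z.map (Int.castRingHom (ZMod 2))).det = 0 := by
      have := RingHom.map_det (Int.castRingHom (ZMod 2)) Z
      rw [h0, map_zero] at this
      exact this.symm
    have h2 : Z.map (Int.castRingHom (ZMod 2)) =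
        1 + Matrix.replicateCol Unit (fun _ : κ => (1 : ZMod 2)) *
          Matrix.replicateRow Unit (fun _ : κ => (1 : ZMod 2)) := by
      ext a b
      by_cases hab : a = b
      · subst hab
        simp [Z, Matrix.mul_apply]
        decide
      · have hne : ((e a : ℕ) - (e b : ℕ) : ℤ) ≠ 0 := by
          rw [sub_ne_zero]
          intro h
          exact hab (e.injective (Fin.ext (by exact_mod_cast h)))
        simp only [Z, Matrix.map_apply, Matrix.of_apply, Matrix.add_apply, Matrix.one_apply_ne hab,
          Matrix.mul_apply]
        rcases lt_or_gt_of_ne hne with h | h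
        · rw [Int.sign_eq_neg_one_of_neg h]
          simp
        · rw [Int.sign_eq_one_of_pos h]
          simp
    rw [h2, Matrix.det_one_add_replicateCol_mul_replicateRow] at h1
    have hcard : Fintype.card κ = n := by
      rw [Fintype.card_congr e, Fintype.card_fin]
    obtain ⟨r, hr⟩ := hn
    simp [dotProduct, hcard, hr] at h1
    have h3 : (r : ZMod 2) + r = 0 := CharTwo.add_self_eq_zero _
    rw [h3] at h1
    simp at h1
  rw [hZ, Matrix.det_smul]
  refine mul_ne_zero (pow_ne_zero _ (by norm_num)) ?_
  have := RingHom.map_det (Int.castRingHom ℂ) Z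
  rw [RingHom.mapMatrix_apply] at this
  rw [← this]
  simpa using hdetZ

lemma epsIndex_transpose {κ : Type*} {n : ℕ} (e : κ ≃ Fin n) :
    (epsIndex e).transpose = -epsIndex e := by
  ext a b
  exact eps_swap _ _

lemma pfaffianSum_epsIndex_ne_zero {m n : ℕ} (e : Fin m ⊕ Fin m ≃ Fin n) :
    Matrix.pfaffianSum (epsIndex e) ≠ 0 := by
  have hn : Even n := ⟨m, by simpa using (Fintype.card_congr e).symm⟩
  intro h
  have := Matrix.pfaffianSum_sq _ (epsIndex_transpose e)
  rw [h] at this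
  have h1 := Matrix.pfaffianSum_stdSkew_ne_zero (ι := Fin m) (K := ℂ)
  have h2 := det_epsIndex_ne_zero e hn
  simp_all

/-- The absolute value of the Vandermonde determinant as a determinant times a Pfaffian. -/
lemma abs_det_vandermonde_mul {ι : Type*} [Fintype ι] [DecidableEq ι] {n : ℕ}
    (e : ι ⊕ ι ≃ Fin n) (y : Fin n → ℝ) :
    ((|(Matrix.vandermonde y).det| : ℝ) : ℂ) * Matrix.pfaffianSum (epsIndex e) =
      ((Matrix.vandermonde y).det : ℂ) *
        Matrix.pfaffianSum (Matrix.of fun a b => eps (y (e a)) (y (e b))) := by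
  by_cases hy : Function.Injective y
  swap
  · have : (Matrix.vandermonde y).det = 0 := by
      by_contra h
      exact hy (Matrix.det_vandermonde_ne_zero_iff.mp h)
    simp [this]
  -- On sorted points the Vandermonde determinant is positive and the ε-matrix is that of the
  -- indices. Undoing the sort multiplies both the determinant and the Pfaffian by the sign of `s`.
  let s := Tuple.sort y
  have hz : StrictMono (y ∘ s) :=
    (Tuple.monotone_sort y).strictMono_of_injective (hy.comp s.injective)
  let s' : Equiv.Perm (ι ⊕ ι) := (e.trans s).trans e.symm
  have hs' : Equiv.Perm.sign s' = Equiv.Perm.sign s := Equiv.Perm.sign_trans_trans_symm s e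
  have h1 : (Matrix.of fun a b => eps (y (e a)) (y (e b))).submatrix s' s' = epsIndex e := by
    ext a b
    have := eps_comp_strictMono hz (e a) (e b)
    simpa [s', epsIndex] using this
  have h2 := Matrix.pfaffianSum_submatrix (Matrix.of fun a b => eps (y (e a)) (y (e b))) s'
  rw [h1, hs'] at h2
  have h3 : (Matrix.vandermonde (y ∘ s)).det = ((Equiv.Perm.sign s : ℤ) : ℝ) *
      (Matrix.vandermonde y).det := Matrix.det_permute s (Matrix.vandermonde y)
  have h4 : 0 < (Matrix.vandermonde (y ∘ s)).det := by
    rw [Matrix.det_vandermonde]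
    refine Finset.prod_pos fun i _ => Finset.prod_pos fun j hj => ?_
    exact sub_pos.mpr (hz (Finset.mem_Ioi.mp hj))
  have h5 : |(Matrix.vandermonde y).det| =
      ((Equiv.Perm.sign s : ℤ) : ℝ) * (Matrix.vandermonde y).det := by
    rw [h3] at h4
    rcases Int.units_eq_one_or (Equiv.Perm.sign s) with h | h <;> rw [h] at h4 ⊢ <;>
      simp at h4 ⊢
    · exact h4.le
    · exact h4.le
  rw [h2, h5]
  have h6 : ((Equiv.Perm.sign s : ℤ) : ℂ) * ((Equiv.Perm.sign s : ℤ) : ℂ) = 1 := by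
    rw [← Int.cast_mul, ← Units.val_mul, Int.units_mul_self]
    simp
  push_cast
  linear_combination ((Matrix.vandermonde y).det : ℂ) *
    Matrix.pfaffianSum (Matrix.of fun a b => eps (y (e a)) (y (e b))) * h6

lemma integrable_mul_eps_mul {μ : Measure ℝ} [SigmaFinite μ] {g h : ℝ → ℂ} (hg : Integrable g μ)
    (hh : Integrable h μ) :
    Integrable (fun p : ℝ × ℝ => g p.1 * eps p.1 p.2 * h p.2) (μ.prod μ) := by
  have h1 := (hg.mul_prod hh).bdd_mul (c := 1) measurable_eps.aestronglyMeasurable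
    (Filter.Eventually.of_forall fun p => norm_eps_le p.1 p.2)
  refine h1.congr (Filter.Eventually.of_forall fun p => ?_)
  simp only
  ring

lemma volume_restrict_cube (n : ℕ) :
    (volume : Measure (Fin n → ℝ)).restrict (cube n) =
      Measure.pi fun _ => (volume : Measure ℝ).restrict J :=
  Measure.restrict_pi_pi (fun _ : Fin n => (volume : Measure ℝ)) fun _ => J

lemma prod_abs_sub_eq_abs_det_vandermonde {n : ℕ} (x : Fin n → ℝ) :
    ∏ j : Fin n, ∏ k ∈ Finset.Ioi j, |x j - x k| ^ 1 = |(Matrix.vandermonde x).det| := by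
  rw [Matrix.det_vandermonde, Finset.abs_prod]
  refine Finset.prod_congr rfl fun i _ => ?_
  rw [Finset.abs_prod]
  exact Finset.prod_congr rfl fun j _ => by rw [pow_one, abs_sub_comm]

/-- The skew form `∫∫ g(x) ε(x,y) h(y) dx dy` on `[-1, 1]`. -/
noncomputable def skewForm (g h : ℝ → ℂ) : ℂ :=
  ∫ p : ℝ × ℝ, g p.1 * eps p.1 p.2 * h p.2 ∂((volume.restrict J).prod (volume.restrict J))

/-- The partition function of the orthogonal ensemble as a Pfaffian. -/
theorem partition_mul_eq_pfaffianSum {m n : ℕ} (e : Fin m ⊕ Fin m ≃ Fin n)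
    (p : Fin n → Polynomial ℝ) (hp : ∀ i, (p i).natDegree ≤ i) (W : ℝ → ℂ)
    (hW : ∀ i, Integrable (fun x => (((p i).eval x : ℝ) : ℂ) * W x) (volume.restrict J)) :
    (((Matrix.of fun i j : Fin n => (p j).coeff i).det : ℝ) : ℂ) *
        Matrix.pfaffianSum (epsIndex e) *
        ∫ x in cube n, ((∏ j : Fin n, ∏ k ∈ Finset.Ioi j, |x j - x k| ^ 1 : ℝ) : ℂ) *
          ∏ j : Fin n, W (x j) =
      n.factorial * Matrix.pfaffianSum (Matrix.of fun a b =>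
        skewForm (fun x => (((p (e a)).eval x : ℝ) : ℂ) * W x) fun x => (((p (e b)).eval x : ℝ) : ℂ) * W x) := by
  have hcard : Fintype.card (Fin m ⊕ Fin m) = n := by
    rw [Fintype.card_congr e, Fintype.card_fin]
  have hint : ∀ a b : Fin m ⊕ Fin m, Integrable (fun q : ℝ × ℝ =>
      (((p (e a)).eval q.1 : ℝ) : ℂ) * W q.1 * eps q.1 q.2 *
        ((((p (e b)).eval q.2 : ℝ) : ℂ) * W q.2))
      ((volume.restrict J).prod (volume.restrict J)) := fun a b =>
    integrable_mul_eps_mul (g := fun x => (((p (e a)).eval x : ℝ) : ℂ) * W x)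
      (h := fun x => (((p (e b)).eval x : ℝ) : ℂ) * W x) (hW (e a)) (hW (e b))
  have key := integral_det_mul_pfaffianSum (volume.restrict J)
    (fun (a : Fin m ⊕ Fin m) x => (((p (e a)).eval x : ℝ) : ℂ) * W x) eps hint
  rw [hcard] at key
  unfold skewForm
  rw [← key, volume_restrict_cube, ← integral_const_mul,
    ← integral_pi_comp_equiv (volume.restrict J) e]
  refine integral_congr_ae (Filter.Eventually.of_forall fun x => ?_)
  simp only
  rw [prod_abs_sub_eq_abs_det_vandermonde]
  have h1 := abs_det_vandermonde_mul e x
  have h2 : Matrix.det (Matrix.of fun a b : Fin m ⊕ Fin m =>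
      (((p (e b)).eval ((x ∘ e) a) : ℝ) : ℂ) * W ((x ∘ e) a)) =
      (∏ j, W (x j)) * (((Matrix.vandermonde x).det : ℂ) *
        ((Matrix.of fun i j : Fin n => (p j).coeff i).det : ℂ)) := by
    -- The weights come out of the rows, and the matrix of polynomial values is the Vandermonde
    -- matrix times the coefficient matrix.
    have h3 : (Matrix.of fun a b : Fin m ⊕ Fin m =>
        (((p (e b)).eval ((x ∘ e) a) : ℝ) : ℂ) * W ((x ∘ e) a)) =
        (Matrix.of fun i j : Fin n => W (x i) *
          ((Matrix.of fun i j => (p j).eval (x i)).map (algebraMap ℝ ℂ)) i j).submatrix e e := by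
      ext a b
      simp [mul_comm]
    rw [h3, Matrix.det_submatrix_equiv_self, Matrix.det_mul_column]
    congr 1
    have h4 := RingHom.map_det (algebraMap ℝ ℂ) (Matrix.of fun i j => (p j).eval (x i))
    rw [RingHom.mapMatrix_apply] at h4
    rw [← h4, Matrix.eval_matrixOfPolynomials_eq_vandermonde_mul_matrixOfPolynomials x p hp,
      Matrix.det_mul]
    simp
  rw [h2]
  simp only [Function.comp_apply]
  linear_combination (((Matrix.of fun i j : Fin n => (p j).coeff i).det : ℂ) *
    ∏ j, W (x j)) * h1

end JacobiEnsemble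

/-! ### Principal minors and Fredholm determinants of finite-rank kernels. -/

namespace Matrix

open Finset

variable {n R : Type*} [Fintype n] [DecidableEq n] [CommRing R]

/-- Expand by multilinearity in the rows, s recording the rows taken from M. -/
lemma det_one_add_eq_sum_principal_minors (M : Matrix n n R) :
    det (1 + M) = ∑ s : Finset n, (M.submatrix (Subtype.val : s → n) Subtype.val).det := by
  rw [add_comm]
  have h := (detRowAlternating : (n → R) [⋀^n]→ₗ[R] R).map_add_univ M.row (1 : Matrix n n R).row
  refine Eq.trans h (Finset.sum_congr rfl fun s _ => ?_)
  exact det_piecewise_one_eq_submatrix_det M s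

lemma card_filter_injective_image_eq (k : ℕ) (s : Finset n) (hs : s.card = k) :
    (univ.filter fun f : Fin k → n => Function.Injective f ∧ univ.image f = s).card =
      k.factorial := by
  have hc : Fintype.card (Fin k ≃ s) = k.factorial := by
    rw [Fintype.card_equiv (Fintype.equivOfCardEq (by simp [hs])), Fintype.card_fin]
  rw [← hc, ← Finset.card_univ]
  symm
  refine Finset.card_bij (fun e _ => fun i => (e i : n)) ?_ ?_ ?_
  · intro e _
    simp only [mem_filter, mem_univ, true_and]
    refine ⟨Subtype.val_injective.comp e.injective, ?_⟩
    ext a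
    simp only [mem_image, mem_univ, true_and]
    constructor
    · rintro ⟨i, rfl⟩
      exact (e i).2
    · intro ha
      exact ⟨e.symm ⟨a, ha⟩, by simp⟩
  · intro e _ e' _ h
    ext i
    exact congrFun h i
  · intro f hf
    obtain ⟨hinj, him⟩ : Function.Injective f ∧ univ.image f = s := by simpa using hf
    have hmem : ∀ i, f i ∈ s := fun i => him ▸ mem_image_of_mem f (mem_univ i)
    refine ⟨Equiv.ofBijective (fun i => ⟨f i, hmem i⟩) ⟨fun i j h => hinj (by simpa using h), ?_⟩,
      mem_univ _, rfl⟩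
    rintro ⟨a, ha⟩
    obtain ⟨i, -, hi⟩ := mem_image.mp (him.symm ▸ ha)
    exact ⟨i, Subtype.ext hi⟩

/-- Repeated indices give zero, and each k-subset is enumerated in k! orders, all with the same
minor. This factorial cancels the one in the Fredholm term. -/
lemma sum_det_submatrix_self (M : Matrix n n R) (k : ℕ) :
    ∑ f : Fin k → n, (M.submatrix f f).det =
      k.factorial * ∑ s ∈ univ.powersetCard k,
        (M.submatrix (Subtype.val : s → n) Subtype.val).det := by
  have hzero : ∀ f : Fin k → n, ¬ Function.Injective f → (M.submatrix f f).det = 0 := by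
    intro f hf
    obtain ⟨i, j, hij, hne⟩ : ∃ i j, f i = f j ∧ i ≠ j := by
      simpa [Function.Injective] using hf
    exact det_zero_of_row_eq hne (by ext; simp [hij])
  have h1 : ∑ f : Fin k → n, (M.submatrix f f).det =
      ∑ f ∈ univ.filter (fun f : Fin k → n => Function.Injective f), (M.submatrix f f).det := by
    symm
    refine sum_subset (filter_subset _ _) fun f _ hf => hzero f fun h => hf (by simpa using h)
  have hmaps : ∀ f ∈ univ.filter (fun f : Fin k → n => Function.Injective f),
      univ.image f ∈ univ.powersetCard k := by
    intro f hf
    have hf' : Function.Injective f := by simpa using hf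
    rw [mem_powersetCard]
    exact ⟨subset_univ _, by rw [card_image_of_injective _ hf', card_univ, Fintype.card_fin]⟩
  rw [h1, ← sum_fiberwise_of_maps_to hmaps, mul_sum]
  refine sum_congr rfl fun s hs => ?_
  have hcard : s.card = k := (mem_powersetCard.mp hs).2
  rw [filter_filter, ← card_filter_injective_image_eq k s hcard, ← nsmul_eq_mul, ← sum_const]
  refine sum_congr rfl fun f hf => ?_
  obtain ⟨hinj, him⟩ : Function.Injective f ∧ univ.image f = s := by simpa using hf
  have hmem : ∀ i, f i ∈ s := fun i => him ▸ mem_image_of_mem f (mem_univ i)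
  let e : Fin k ≃ s := Equiv.ofBijective (fun i => ⟨f i, hmem i⟩)
    ((Fintype.bijective_iff_injective_and_card _).mpr
    ⟨fun i j h => hinj (by simpa using h), by simp [hcard]⟩)
  rw [← det_submatrix_equiv_self e]
  rfl

end Matrix

namespace JacobiEnsemble

/-- The terms of the Fredholm series of a kernel of finite rank. -/
lemma fredholmTerm_of_finite_rank {N : ℕ} (u v : Fin N → ℝ → ℂ) (K : ℝ → ℝ → ℂ)
    (hK : ∀ x y, K x y = ∑ k, u k x * v k y)
    (hint : ∀ i j, Integrable (fun x => v i x * u j x) (volume.restrict J)) (n : ℕ) :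
    fredholmTerm K n = ∑ s ∈ (Finset.univ : Finset (Fin N)).powersetCard n,
      ((Matrix.of fun i j => ∫ x in J, v i x * u j x).submatrix
        (Subtype.val : s → Fin N) Subtype.val).det := by
  set M : Matrix (Fin N) (Fin N) ℂ := Matrix.of fun i j => ∫ x in J, v i x * u j x with hM
  have hexp : ∀ x : Fin n → ℝ, Matrix.det (Matrix.of fun i j : Fin n => K (x i) (x j)) =
      ∑ f : Fin n → Fin N, ∑ σ : Equiv.Perm (Fin n), ((Equiv.Perm.sign σ : ℤ) : ℂ) *
        ∏ j, (v (f j) (x j) * u (f (σ⁻¹ j)) (x j)) := by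
    intro x
    rw [Matrix.det_apply', Finset.sum_comm]
    refine Finset.sum_congr rfl fun σ _ => ?_
    rw [← Finset.mul_sum]
    congr 1
    simp only [Matrix.of_apply, hK]
    rw [Finset.prod_univ_sum, Fintype.piFinset_univ]
    refine Finset.sum_congr rfl fun f _ => ?_
    rw [Finset.prod_mul_distrib, Finset.prod_mul_distrib, mul_comm]
    congr 1
    -- Reindexing the u-factors gathers everything depending on a given x_j, so the integral splits
    -- into one-dimensional ones.
    rw [← Equiv.prod_comp σ fun j => u (f (σ⁻¹ j)) (x j)]
    simp
  have hI : ∀ (f : Fin n → Fin N) (σ : Equiv.Perm (Fin n)), Integrable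
      (fun x : Fin n → ℝ => ((Equiv.Perm.sign σ : ℤ) : ℂ) *
        ∏ j, (v (f j) (x j) * u (f (σ⁻¹ j)) (x j)))
      (Measure.pi fun _ => volume.restrict J) := fun f σ =>
    (Integrable.fintype_prod (f := fun j y => v (f j) y * u (f (σ⁻¹ j)) y)
      fun j => hint _ _).const_mul _
  have hint2 : ∫ x in cube n, Matrix.det (Matrix.of fun i j : Fin n => K (x i) (x j)) =
      ∑ f : Fin n → Fin N, (M.submatrix f f).det := by
    rw [volume_restrict_cube]
    simp_rw [hexp]
    rw [integral_finsetSum _ fun f _ => integrable_finsetSum _ fun σ _ => hI f σ]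
    refine Finset.sum_congr rfl fun f _ => ?_
    rw [integral_finsetSum _ fun σ _ => hI f σ, Matrix.det_apply']
    refine Finset.sum_congr rfl fun σ _ => ?_
    rw [integral_const_mul, integral_fintype_prod_eq_prod (fun j y => v (f j) y * u (f (σ⁻¹ j)) y)]
    congr 1
    rw [← Equiv.prod_comp σ]
    simp [hM]
  unfold fredholmTerm
  rw [hint2, Matrix.sum_det_submatrix_self, ← mul_assoc, one_div,
    inv_mul_cancel₀ (Nat.cast_ne_zero.mpr n.factorial_ne_zero), one_mul]

/-- The Fredholm determinant of a kernel of finite rank. -/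
theorem fredholmDet_of_finite_rank {N : ℕ} (u v : Fin N → ℝ → ℂ) (K : ℝ → ℝ → ℂ)
    (hK : ∀ x y, K x y = ∑ k, u k x * v k y)
    (hint : ∀ i j, Integrable (fun x => v i x * u j x) (volume.restrict J)) :
    Summable (fredholmTerm K) ∧
      fredholmDet K = Matrix.det (1 + Matrix.of fun i j => ∫ x in J, v i x * u j x) := by
  -- A set of N indices has no subset of more than N elements, so the series terminates.
  have hzero : ∀ n ∉ Finset.range (N + 1), fredholmTerm K n = 0 := by
    intro n hn
    rw [fredholmTerm_of_finite_rank u v K hK hint, Finset.powersetCard_eq_empty.mpr (by simpa using hn),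
      Finset.sum_empty]
  refine ⟨summable_of_ne_finset_zero hzero, ?_⟩
  unfold fredholmDet
  rw [tsum_eq_sum hzero, Matrix.det_one_add_eq_sum_principal_minors]
  simp_rw [fredholmTerm_of_finite_rank u v K hK hint]
  have hmaps : ∀ s ∈ (Finset.univ : Finset (Finset (Fin N))), s.card ∈ Finset.range (N + 1) := by
    intro s _
    have := Finset.card_le_univ s
    simp at this ⊢
    omega
  rw [← Finset.sum_fiberwise_of_maps_to hmaps]
  refine Finset.sum_congr rfl fun n _ => Finset.sum_congr ?_ fun _ _ => rfl
  ext s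
  simp [Finset.mem_powersetCard]

end JacobiEnsemble

namespace JacobiEnsemble

/-! ### The Jacobi weight and its Pearson equation. -/

section Weight

/-- The Jacobi weight `(1-x)^s (1+x)^t`. -/
noncomputable def jacobiWeight (s t x : ℝ) : ℝ := (1 - x) ^ s * (1 + x) ^ t

/-- The operator `p ↦ w⁻¹ ((1-x²) w p)'` on polynomials, for the Jacobi weight `w`. -/
noncomputable def pearsonOp (s t : ℝ) (p : Polynomial ℝ) : Polynomial ℝ :=
  (1 - Polynomial.X ^ 2) * Polynomial.derivative p +
    (Polynomial.C (t - s) - Polynomial.C (s + t + 2) * Polynomial.X) * p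

variable {s t : ℝ}

lemma continuousOn_jacobiWeight : ContinuousOn (jacobiWeight s t) (Set.Ioo (-1) 1) := by
  unfold jacobiWeight
  refine ContinuousOn.mul ?_ ?_
  · refine ContinuousOn.rpow_const (by fun_prop) fun x hx => Or.inl ?_
    linarith [hx.2]
  · refine ContinuousOn.rpow_const (by fun_prop) fun x hx => Or.inl ?_
    linarith [hx.1]

lemma jacobiWeight_pos {x : ℝ} (hx : x ∈ Set.Ioo (-1 : ℝ) 1) : 0 < jacobiWeight s t x :=
  mul_pos (Real.rpow_pos_of_pos (by linarith [hx.2]) _) (Real.rpow_pos_of_pos (by linarith [hx.1]) _)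

/-- Splitting at 0 isolates one endpoint singularity in each half, integrable because its exponent
exceeds -1. -/
lemma integrableOn_jacobiWeight (hs : -1 < s) (ht : -1 < t) :
    IntegrableOn (jacobiWeight s t) J := by
  have hJ : J = Set.Icc (-1 : ℝ) 0 ∪ Set.Icc 0 1 := by
    rw [Set.Icc_union_Icc_eq_Icc (by norm_num) (by norm_num)]
    rfl
  have h1 : IntegrableOn (fun x : ℝ => (1 + x) ^ t) (Set.Icc (-1) 0) := by
    rw [integrableOn_Icc_iff_integrableOn_Ioc,
      ← intervalIntegrable_iff_integrableOn_Ioc_of_le (by norm_num)]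
    have := (intervalIntegral.intervalIntegrable_rpow' (a := 0) (b := 1) ht).comp_add_left 1
    simpa using this
  have h2 : IntegrableOn (fun x : ℝ => (1 - x) ^ s) (Set.Icc 0 1) := by
    rw [integrableOn_Icc_iff_integrableOn_Ioc,
      ← intervalIntegrable_iff_integrableOn_Ioc_of_le (by norm_num)]
    have := (intervalIntegral.intervalIntegrable_rpow' (a := 0) (b := 1) hs).comp_sub_left 1
    simpa using this.symm
  rw [hJ]
  refine IntegrableOn.union ?_ ?_
  · refine h1.continuousOn_mul ?_ isCompact_Icc
    exact ContinuousOn.rpow_const (by fun_prop) fun x hx => Or.inl (by linarith [hx.2])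
  · refine h2.mul_continuousOn ?_ isCompact_Icc
    exact ContinuousOn.rpow_const (by fun_prop) fun x hx => Or.inl (by linarith [hx.1])

lemma integrableOn_eval_mul_jacobiWeight (hs : -1 < s) (ht : -1 < t) (p : Polynomial ℝ) :
    IntegrableOn (fun x => p.eval x * jacobiWeight s t x) J :=
  (integrableOn_jacobiWeight hs ht).continuousOn_mul p.continuous.continuousOn isCompact_Icc

/-- The endpoints are included: s + 1 and t + 1 are nonzero, so the vanishing power on the right
agrees with the vanishing factor on the left. This makes the primitives below continuous on the
closed interval. -/
lemma one_sub_sq_mul_jacobiWeight (hs : -1 < s) (ht : -1 < t) {x : ℝ} (hx : x ∈ J) :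
    (1 - x ^ 2) * jacobiWeight s t x = jacobiWeight (s + 1) (t + 1) x := by
  unfold jacobiWeight
  rw [Real.rpow_add_one' (by linarith [hx.2]) (by linarith),
    Real.rpow_add_one' (by linarith [hx.1]) (by linarith)]
  ring

lemma continuousOn_one_sub_sq_mul (hs : -1 < s) (ht : -1 < t) (p : Polynomial ℝ) :
    ContinuousOn (fun x => (1 - x ^ 2) * (p.eval x * jacobiWeight s t x)) J := by
  have : ContinuousOn (fun x => p.eval x * jacobiWeight (s + 1) (t + 1) x) J := by
    unfold jacobiWeight
    refine p.continuous.continuousOn.mul (ContinuousOn.mul ?_ ?_)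
    · exact ContinuousOn.rpow_const (by fun_prop) fun x hx => Or.inr (by linarith)
    · exact ContinuousOn.rpow_const (by fun_prop) fun x hx => Or.inr (by linarith)
  refine this.congr fun x hx => ?_
  simp only
  rw [← one_sub_sq_mul_jacobiWeight hs ht hx]
  ring

lemma hasDerivAt_one_sub_sq_mul (p : Polynomial ℝ) {x : ℝ} (hx : x ∈ Set.Ioo (-1 : ℝ) 1) :
    HasDerivAt (fun x => (1 - x ^ 2) * (p.eval x * jacobiWeight s t x))
      ((pearsonOp s t p).eval x * jacobiWeight s t x) x := by
  have h1 : (0 : ℝ) < 1 - x := by linarith [hx.2]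
  have h2 : (0 : ℝ) < 1 + x := by linarith [hx.1]
  have d1 : HasDerivAt (fun x : ℝ => (1 - x) ^ s) (-1 * s * (1 - x) ^ (s - 1)) x :=
    ((hasDerivAt_id x).const_sub 1).rpow_const (Or.inl h1.ne')
  have d2 : HasDerivAt (fun x : ℝ => (1 + x) ^ t) (1 * t * (1 + x) ^ (t - 1)) x :=
    ((hasDerivAt_id x).const_add 1).rpow_const (Or.inl h2.ne')
  have d3 : HasDerivAt (fun x : ℝ => 1 - x ^ 2) (-(2 * x)) x := by
    simpa using (hasDerivAt_pow 2 x).const_sub 1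
  have := d3.mul ((p.hasDerivAt x).mul (d1.mul d2))
  refine this.congr_deriv ?_
  simp only [pearsonOp, jacobiWeight, Polynomial.eval_add, Polynomial.eval_mul, Polynomial.eval_sub,
    Polynomial.eval_one, Polynomial.eval_pow, Polynomial.eval_X, Polynomial.eval_C, Pi.mul_apply]
  rw [Real.rpow_sub_one h1.ne', Real.rpow_sub_one h2.ne']
  field_simp
  ring

lemma integral_J_eq (F : ℝ → ℝ) : ∫ x in J, F x = ∫ x in (-1 : ℝ)..1, F x := by
  rw [intervalIntegral.integral_of_le (by norm_num), ← integral_Icc_eq_integral_Ioc]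
  rfl

/-- The integrand is an exact derivative whose primitive carries the factor 1 - x², so there are no
boundary terms. -/
lemma integral_pearsonOp (hs : -1 < s) (ht : -1 < t) (p : Polynomial ℝ) :
    ∫ x in J, (pearsonOp s t p).eval x * jacobiWeight s t x = 0 := by
  rw [integral_J_eq, intervalIntegral.integral_eq_sub_of_hasDerivAt_of_le (by norm_num)
    (continuousOn_one_sub_sq_mul hs ht p) fun x hx => hasDerivAt_one_sub_sq_mul p hx]
  · norm_num
  · rw [intervalIntegrable_iff_integrableOn_Icc_of_le (by norm_num)]
    exact integrableOn_eval_mul_jacobiWeight hs ht _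

/-- The Leibniz rule for the square-root weight v with exponents (α-1)/2, (β-1)/2: since (1-x²)v² is
the weight with exponents α, β, the primitive for pq is the product of those for p and q. -/
lemma pearsonOp_mul (α β : ℝ) (p q : Polynomial ℝ) :
    pearsonOp α β (p * q) = p * pearsonOp ((α - 1) / 2) ((β - 1) / 2) q +
      q * pearsonOp ((α - 1) / 2) ((β - 1) / 2) p := by
  have h1 : Polynomial.C (β - α) = 2 * Polynomial.C ((β - 1) / 2 - (α - 1) / 2) := by
    rw [show (2 : Polynomial ℝ) = Polynomial.C 2 from rfl, ← Polynomial.C_mul]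
    congr 1
    ring
  have h2 : Polynomial.C (α + β + 2) = 2 * Polynomial.C ((α - 1) / 2 + (β - 1) / 2 + 2) := by
    rw [show (2 : Polynomial ℝ) = Polynomial.C 2 from rfl, ← Polynomial.C_mul]
    congr 1
    ring
  unfold pearsonOp
  rw [h1, h2, Polynomial.derivative_mul]
  ring

end Weight

/-! ### Coefficient relations of the Jacobi polynomials in (x-1)/2. -/

section Coefficients

variable (α β : ℝ)

/-- The coefficient of `((x-1)/2)^k` in `P_n^{(α,β)}`. -/
noncomputable def jacobiCoeff (n k : ℕ) : ℝ :=
  if k ≤ n then (ascPochhammer ℝ k).eval ((n : ℝ) + α + β + 1) *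
        (ascPochhammer ℝ (n - k)).eval (α + (k : ℝ) + 1) /
        ((k.factorial : ℝ) * ((n - k).factorial : ℝ)) else 0

lemma jacobiCoeff_add (k d : ℕ) : jacobiCoeff α β (k + d) k =
    (ascPochhammer ℝ k).eval ((k : ℝ) + d + α + β + 1) *
      (ascPochhammer ℝ d).eval (α + (k : ℝ) + 1) / ((k.factorial : ℝ) * (d.factorial : ℝ)) := by
  simp [jacobiCoeff]

lemma jacobiCoeff_of_lt {n k : ℕ} (h : n < k) : jacobiCoeff α β n k = 0 := by
  simp [jacobiCoeff, h]

lemma ascPochhammer_eval_succ_left (x : ℝ) (n : ℕ) :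
    (ascPochhammer ℝ (n + 1)).eval x = x * (ascPochhammer ℝ n).eval (x + 1) := by
  simp [ascPochhammer_succ_left, Polynomial.eval_comp]

/-- The hypergeometric term ratio: read coefficientwise, it is the Jacobi differential equation. -/
lemma jacobiCoeff_succ_right (n k : ℕ) :
    jacobiCoeff α β n (k + 1) * ((k + 1) * (α + k + 1)) =
      jacobiCoeff α β n k * ((n - k) * (n + α + β + 1 + k)) := by
  rcases lt_trichotomy n k with h | rfl | h
  · rw [jacobiCoeff_of_lt _ _ h, jacobiCoeff_of_lt _ _ (by omega)]
    ring
  · rw [jacobiCoeff_of_lt _ _ (Nat.lt_succ_self _)]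
    ring
  · obtain ⟨d, rfl⟩ := Nat.exists_eq_add_of_le (Nat.succ_le_of_lt h)
    have e1 := jacobiCoeff_add α β (k + 1) d
    have e2 := jacobiCoeff_add α β k (d + 1)
    rw [show k + (d + 1) = k + 1 + d by ring] at e2
    rw [Nat.succ_eq_add_one, e1, e2, ascPochhammer_succ_eval, ascPochhammer_eval_succ_left _ d,
      Nat.factorial_succ, Nat.factorial_succ]
    push_cast
    rw [show α + ((k : ℝ) + 1) + 1 = α + k + 1 + 1 by ring,
      show (k : ℝ) + 1 + d + α + β + 1 = k + (d + 1) + α + β + 1 by ring]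
    field_simp
    ring

/-- With `jacobiCoeff_pred_succ`, this ties neighbouring degrees together, so that the three-term
recurrence below reduces to a rational identity multiplying a single coefficient. The division-free
form also covers k > n. -/
lemma jacobiCoeff_succ_succ (n k : ℕ) :
    jacobiCoeff α β (n + 1) (k + 1) * ((k + 1) * (α + k + 1) * (n + α + β + 1)) =
      jacobiCoeff α β n k * ((n + α + β + k + 1) * (n + α + β + k + 2) * (α + n + 1)) := by
  rcases lt_or_ge n k with h | h
  · rw [jacobiCoeff_of_lt _ _ h, jacobiCoeff_of_lt _ _ (by omega)]
    ring
  · obtain ⟨d, rfl⟩ := Nat.exists_eq_add_of_le h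
    have e1 := jacobiCoeff_add α β (k + 1) d
    have e2 := jacobiCoeff_add α β k d
    rw [show k + 1 + d = k + d + 1 by ring] at e1
    have p1 := ascPochhammer_eval_succ_left ((k : ℝ) + d + α + β + 1) (k + 1)
    rw [ascPochhammer_succ_eval, ascPochhammer_succ_eval] at p1
    have p2 := ascPochhammer_eval_succ_left (α + (k : ℝ) + 1) d
    rw [ascPochhammer_succ_eval] at p2
    rw [e1, e2, Nat.factorial_succ]
    push_cast at p1 ⊢
    rw [show (k : ℝ) + 1 + d + α + β + 1 = k + d + α + β + 1 + 1 by ring,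
      show α + ((k : ℝ) + 1) + 1 = α + k + 1 + 1 by ring]
    set a1 := (ascPochhammer ℝ (k + 1)).eval ((k : ℝ) + d + α + β + 1 + 1)
    set a2 := (ascPochhammer ℝ d).eval (α + (k : ℝ) + 1 + 1)
    set a3 := (ascPochhammer ℝ k).eval ((k : ℝ) + d + α + β + 1)
    set a4 := (ascPochhammer ℝ d).eval (α + (k : ℝ) + 1)
    have hf := Nat.cast_ne_zero (R := ℝ) |>.mpr k.factorial_ne_zero
    have hf' := Nat.cast_ne_zero (R := ℝ) |>.mpr d.factorial_ne_zero
    have hk : (k : ℝ) + 1 ≠ 0 := by positivity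
    field_simp
    linear_combination (-(a2 * (α + k + 1))) * p1 -
      a3 * (↑k + ↑d + α + β + 1 + ↑k) * (↑k + ↑d + α + β + 1 + (↑k + 1)) * p2

lemma jacobiCoeff_pred_succ (n k : ℕ) :
    jacobiCoeff α β n (k + 1) * ((k + 1) * (α + k + 1) * (α + n + 1)) =
      jacobiCoeff α β (n + 1) k * ((n + 1 - k) * (n - k) * (n + 1 + α + β)) := by
  rcases lt_trichotomy n k with h | rfl | h
  · rcases Nat.eq_or_lt_of_le (Nat.succ_le_of_lt h) with h' | h'
    · rw [jacobiCoeff_of_lt _ _ (by omega : n < k + 1), ← h']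
      push_cast
      ring
    · rw [jacobiCoeff_of_lt _ _ (by omega : n + 1 < k), jacobiCoeff_of_lt _ _ (by omega)]
      ring
  · rw [jacobiCoeff_of_lt _ _ (Nat.lt_succ_self _)]
    ring
  · obtain ⟨d, rfl⟩ := Nat.exists_eq_add_of_le (Nat.succ_le_of_lt h)
    have e1 := jacobiCoeff_add α β (k + 1) d
    have e2 := jacobiCoeff_add α β k (d + 2)
    rw [show k + (d + 2) = k + 1 + d + 1 by ring] at e2
    have p1 := ascPochhammer_eval_succ_left ((k : ℝ) + 1 + d + α + β + 1) k
    rw [Nat.succ_eq_add_one, e1, e2, ascPochhammer_eval_succ_left _ k,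
      ascPochhammer_eval_succ_left _ (d + 1), ascPochhammer_succ_eval, Nat.factorial_succ,
      Nat.factorial_succ (d + 1), Nat.factorial_succ d]
    push_cast
    rw [show α + ((k : ℝ) + 1) + 1 = α + k + 1 + 1 by ring,
      show (k : ℝ) + 1 + d + α + β + 1 + 1 = k + (d + 2) + α + β + 1 by ring]
    field_simp
    ring

lemma jacobiCoeff_zero_right (n : ℕ) :
    jacobiCoeff α β (n + 1) 0 * (n + 1) = jacobiCoeff α β n 0 * (α + n + 1) := by
  simp only [jacobiCoeff, Nat.zero_le, if_true, ascPochhammer_zero, Polynomial.eval_one, Nat.sub_zero,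
    ascPochhammer_succ_eval, Nat.factorial_succ, Nat.factorial_zero]
  push_cast
  field_simp
  ring

/-- `P_n^{(α,β)}` as a polynomial in `(x-1)/2`. -/
noncomputable def jacobiShift (n : ℕ) : Polynomial ℝ :=
  ∑ k ∈ Finset.range (n + 1), Polynomial.C (jacobiCoeff α β n k) * Polynomial.X ^ k

lemma jacobiP_eq_comp (n : ℕ) : jacobiP α β n =
    (jacobiShift α β n).comp (Polynomial.C (1 / 2 : ℝ) * (Polynomial.X - 1)) := by
  unfold jacobiP jacobiShift
  rw [Polynomial.sum_comp]
  refine Finset.sum_congr rfl fun k hk => ?_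
  rw [Polynomial.mul_comp, Polynomial.C_comp, Polynomial.X_pow_comp, jacobiCoeff,
    if_pos (by simpa [Nat.lt_succ_iff] using hk)]

lemma coeff_jacobiShift (n k : ℕ) : (jacobiShift α β n).coeff k = jacobiCoeff α β n k := by
  unfold jacobiShift
  rw [Polynomial.finsetSum_coeff]
  simp only [Polynomial.coeff_C_mul, Polynomial.coeff_X_pow, mul_ite, mul_one, mul_zero]
  rw [Finset.sum_ite_eq]
  split_ifs with h
  · rfl
  · rw [jacobiCoeff_of_lt]
    simpa using h

lemma jacobiShift_ode (n : ℕ) :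
    Polynomial.X * (1 + Polynomial.X) * Polynomial.derivative (Polynomial.derivative (jacobiShift α β n)) +
      (Polynomial.C (α + 1) + Polynomial.C (α + β + 2) * Polynomial.X) *
        Polynomial.derivative (jacobiShift α β n) -
      Polynomial.C ((n : ℝ) * (n + α + β + 1)) * jacobiShift α β n = 0 := by
  ext k
  rw [mul_assoc, add_mul, add_mul, one_mul, mul_add, mul_assoc (Polynomial.C (α + β + 2))]
  -- Naming the constants keeps `simp` from distributing `C` over their sums while coefficients are
  -- extracted.
  generalize he1 : α + 1 = e1
  generalize he2 : α + β + 2 = e2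
  generalize he3 : (n : ℝ) * (n + α + β + 1) = e3
  rcases k with _ | _ | k
  · have := jacobiCoeff_succ_right α β n 0
    simp [Polynomial.coeff_derivative, coeff_jacobiShift] at this ⊢
    subst he1 he2 he3
    linear_combination this
  · have := jacobiCoeff_succ_right α β n 1
    simp [Polynomial.coeff_derivative, coeff_jacobiShift] at this ⊢
    subst he1 he2 he3
    linear_combination this
  · have := jacobiCoeff_succ_right α β n (k + 2)
    simp [Polynomial.coeff_derivative, coeff_jacobiShift] at this ⊢
    subst he1 he2 he3
    linear_combination this

end Coefficients

end JacobiEnsemble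

namespace JacobiEnsemble

/-! ### The differential equation and the Pearson recurrence. -/

section Recurrence

variable {α β : ℝ}

lemma eval_jacobiP (n : ℕ) (x : ℝ) :
    (jacobiP α β n).eval x = (jacobiShift α β n).eval ((x - 1) / 2) := by
  rw [jacobiP_eq_comp, Polynomial.eval_comp]
  congr 1
  simp
  ring

lemma derivative_comp_half (q : Polynomial ℝ) :
    Polynomial.derivative (q.comp (Polynomial.C (1 / 2 : ℝ) * (Polynomial.X - 1))) =
      Polynomial.C (1 / 2) *
        (Polynomial.derivative q).comp (Polynomial.C (1 / 2 : ℝ) * (Polynomial.X - 1)) := by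
  rw [Polynomial.derivative_comp]
  simp

lemma eval_derivative_jacobiP (n : ℕ) (x : ℝ) :
    (Polynomial.derivative (jacobiP α β n)).eval x =
      (Polynomial.derivative (jacobiShift α β n)).eval ((x - 1) / 2) / 2 := by
  rw [jacobiP_eq_comp, derivative_comp_half, Polynomial.eval_mul, Polynomial.eval_comp]
  rw [show Polynomial.eval x (Polynomial.C (1 / 2 : ℝ) * (Polynomial.X - 1)) = (x - 1) / 2 by
    simp; ring]
  simp
  ring

lemma eval_derivative_derivative_jacobiP (n : ℕ) (x : ℝ) :
    (Polynomial.derivative (Polynomial.derivative (jacobiP α β n))).eval x =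
      (Polynomial.derivative (Polynomial.derivative (jacobiShift α β n))).eval ((x - 1) / 2) / 4 := by
  rw [jacobiP_eq_comp, derivative_comp_half, Polynomial.derivative_C_mul, derivative_comp_half,
    Polynomial.eval_mul, Polynomial.eval_mul, Polynomial.eval_comp]
  rw [show Polynomial.eval x (Polynomial.C (1 / 2 : ℝ) * (Polynomial.X - 1)) = (x - 1) / 2 by
    simp; ring]
  simp
  ring

lemma jacobiP_ode (n : ℕ) (x : ℝ) :
    (1 - x ^ 2) * (Polynomial.derivative (Polynomial.derivative (jacobiP α β n))).eval x +
      (β - α - (α + β + 2) * x) * (Polynomial.derivative (jacobiP α β n)).eval x +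
      n * (n + α + β + 1) * (jacobiP α β n).eval x = 0 := by
  have h := congrArg (Polynomial.eval ((x - 1) / 2)) (jacobiShift_ode α β n)
  simp only [Polynomial.eval_add, Polynomial.eval_sub, Polynomial.eval_mul, Polynomial.eval_X,
    Polynomial.eval_C, Polynomial.eval_one, Polynomial.eval_zero] at h
  rw [eval_jacobiP, eval_derivative_jacobiP, eval_derivative_derivative_jacobiP]
  linear_combination -h

/-- The upper coefficient in `((1-x²) w P_n)' = w (-A_n P_{n+1} + B_n P_{n-1})`. -/
noncomputable def pearsonUpper (α β : ℝ) : ℕ → ℝ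
  | 0 => 1
  | n + 1 => (n + 2) * (n + α + β + 2) / (2 * n + α + β + 3)

/-- The lower coefficient in `((1-x²) w P_n)' = w (-A_n P_{n+1} + B_n P_{n-1})`, at `n + 1`. -/
noncomputable def pearsonLower (α β : ℝ) (n : ℕ) : ℝ :=
  (α + n + 1) * (β + n + 1) / (2 * n + α + β + 3)

/-- Degree zero is separate: the general formula for the upper coefficient would be (α+β+1)/(α+β+1),
which is 0/0 when α + β = -1, whereas the value needed is 1. -/
lemma jacobiShift_pearson_zero :
    2 * (Polynomial.X * ((1 + Polynomial.X) * Polynomial.derivative (jacobiShift α β 0))) +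
      (Polynomial.C (α + 1) + Polynomial.C (α + β + 2) * Polynomial.X) * jacobiShift α β 0 =
      jacobiShift α β 1 := by
  have h0 : jacobiShift α β 0 = 1 := by
    simp [jacobiShift, jacobiCoeff]
  have h1 : jacobiShift α β 1 =
      Polynomial.C (α + 1) + Polynomial.C (α + β + 2) * Polynomial.X := by
    have : 1 + α + β + 1 = α + β + 2 := by ring
    simp only [jacobiShift, Finset.sum_range_succ, Finset.sum_range_zero, jacobiCoeff]
    simp [-map_add, this]
  rw [h0, h1]
  simp

/-- Compare coefficients: the term ratios express each one at index k + 1 through that of degree n +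
1 at index k, and constant terms are treated directly. The bounds on α, β keep the denominators
nonzero. -/
lemma jacobiShift_pearson_succ (hα : -1 < α) (hβ : -1 < β) (n : ℕ) :
    2 * (Polynomial.X * ((1 + Polynomial.X) * Polynomial.derivative (jacobiShift α β (n + 1)))) +
      (Polynomial.C (α + 1) + Polynomial.C (α + β + 2) * Polynomial.X) * jacobiShift α β (n + 1) =
      Polynomial.C (pearsonUpper α β (n + 1)) * jacobiShift α β (n + 2) -
        Polynomial.C (pearsonLower α β n) * jacobiShift α β n := by
  have hn : (0 : ℝ) ≤ n := n.cast_nonneg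
  have d1 : α + n + 1 ≠ 0 := by linarith
  have d2 : 2 * n + α + β + 3 ≠ 0 := by linarith
  have d3 : (n : ℝ) + 1 + α + β + 1 ≠ 0 := by linarith
  ext k
  rw [add_mul, one_mul, mul_add, add_mul, mul_assoc (Polynomial.C (α + β + 2)),
    show (2 : Polynomial ℝ) = Polynomial.C 2 from rfl]
  generalize he1 : α + 1 = e1
  generalize he2 : α + β + 2 = e2
  generalize he3 : pearsonUpper α β (n + 1) = e3
  generalize he4 : pearsonLower α β n = e4
  rcases k with _ | k
  · have r1 := jacobiCoeff_zero_right α β n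
    have r2 := jacobiCoeff_zero_right α β (n + 1)
    simp [Polynomial.coeff_derivative, coeff_jacobiShift]
    subst he1 he3 he4
    have h1 : jacobiCoeff α β n 0 = jacobiCoeff α β (n + 1) 0 * (n + 1) / (α + n + 1) := by
      rw [r1]
      field_simp
    have h2 : jacobiCoeff α β (n + 2) 0 =
        jacobiCoeff α β (n + 1) 0 * (α + n + 2) / (n + 2) := by
      push_cast at r2
      rw [eq_div_iff (by positivity)]
      linear_combination r2
    rw [h1, h2]
    simp only [pearsonUpper, pearsonLower]
    have d6 : (n : ℝ) + 2 ≠ 0 := by linarith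
    rw [eq_comm, div_mul_div_comm, div_mul_div_comm, div_sub_div _ _ (mul_ne_zero d2 d6)
      (mul_ne_zero d2 d1), div_eq_iff (mul_ne_zero (mul_ne_zero d2 d6) (mul_ne_zero d2 d1))]
    ring
  · have hk : (0 : ℝ) ≤ k := k.cast_nonneg
    have d4 : α + k + 1 ≠ 0 := by linarith
    have d5 : (k : ℝ) + 1 ≠ 0 := by linarith
    have r1 := jacobiCoeff_succ_right α β (n + 1) k
    have r3 := jacobiCoeff_succ_succ α β (n + 1) k
    have r4 := jacobiCoeff_pred_succ α β n k
    have h1 := eq_div_of_mul_eq (mul_ne_zero d5 d4) r1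
    have h3 := eq_div_of_mul_eq (mul_ne_zero (mul_ne_zero d5 d4) (by push_cast; exact d3)) r3
    have h4 := eq_div_of_mul_eq (mul_ne_zero (mul_ne_zero d5 d4) d1) r4
    have hgoal : 2 * ((k + 1) * jacobiCoeff α β (n + 1) (k + 1) + k * jacobiCoeff α β (n + 1) k) +
        ((α + 1) * jacobiCoeff α β (n + 1) (k + 1) + (α + β + 2) * jacobiCoeff α β (n + 1) k) =
        pearsonUpper α β (n + 1) * jacobiCoeff α β (n + 2) (k + 1) -
          pearsonLower α β n * jacobiCoeff α β n (k + 1) := by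
      rw [h1, h3, h4]
      simp only [pearsonUpper, pearsonLower]
      push_cast at d3 ⊢
      field_simp
      ring
    rcases k with _ | k
    · simp [Polynomial.coeff_derivative, coeff_jacobiShift]
      subst he1 he2 he3 he4
      simp at hgoal
      linear_combination hgoal
    · simp [Polynomial.coeff_derivative, coeff_jacobiShift]
      subst he1 he2 he3 he4
      push_cast at hgoal
      linear_combination hgoal

lemma eval_pearsonOp_jacobiP (n : ℕ) (x : ℝ) :
    (pearsonOp ((α - 1) / 2) ((β - 1) / 2) (jacobiP α β n)).eval x =
      -(2 * (Polynomial.X * ((1 + Polynomial.X) * Polynomial.derivative (jacobiShift α β n))) +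
      (Polynomial.C (α + 1) + Polynomial.C (α + β + 2) * Polynomial.X) *
        jacobiShift α β n).eval ((x - 1) / 2) := by
  simp only [pearsonOp, Polynomial.eval_add, Polynomial.eval_sub, Polynomial.eval_mul,
    Polynomial.eval_X, Polynomial.eval_C, Polynomial.eval_one, Polynomial.eval_pow,
    Polynomial.eval_ofNat, eval_jacobiP, eval_derivative_jacobiP]
  ring

lemma pearsonOp_jacobiP_zero :
    pearsonOp ((α - 1) / 2) ((β - 1) / 2) (jacobiP α β 0) =
      -(Polynomial.C (pearsonUpper α β 0) * jacobiP α β 1) := by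
  refine Polynomial.funext fun x => ?_
  rw [eval_pearsonOp_jacobiP, jacobiShift_pearson_zero]
  simp [pearsonUpper, eval_jacobiP]

lemma pearsonOp_jacobiP_succ (hα : -1 < α) (hβ : -1 < β) (n : ℕ) :
    pearsonOp ((α - 1) / 2) ((β - 1) / 2) (jacobiP α β (n + 1)) =
      -(Polynomial.C (pearsonUpper α β (n + 1)) * jacobiP α β (n + 2)) +
        Polynomial.C (pearsonLower α β n) * jacobiP α β n := by
  refine Polynomial.funext fun x => ?_
  rw [eval_pearsonOp_jacobiP, jacobiShift_pearson_succ hα hβ]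
  simp [eval_jacobiP]
  ring

end Recurrence

/-! ### Orthogonality and norms. -/

section Orthogonality

variable {α β : ℝ}

/-- For n ≥ 1 the rising factorial starts at n + α + β + 1 > 0; for n = 0 it is empty, and α + β + 1
may have any sign. -/
lemma jacobiCoeff_self_ne_zero (hα : -1 < α) (hβ : -1 < β) (n : ℕ) :
    jacobiCoeff α β n n ≠ 0 := by
  have h := jacobiCoeff_add α β n 0
  rw [add_zero] at h
  rw [h]
  rcases n with _ | n
  · simp
  · have hn : (0 : ℝ) ≤ n := n.cast_nonneg
    have : 0 < (ascPochhammer ℝ (n + 1)).eval (((n + 1 : ℕ) : ℝ) + (0 : ℕ) + α + β + 1) :=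
      ascPochhammer_pos _ _ (by push_cast; linarith)
    simp only [ascPochhammer_zero, Polynomial.eval_one, mul_one]
    positivity

lemma natDegree_jacobiShift (hα : -1 < α) (hβ : -1 < β) (n : ℕ) :
    (jacobiShift α β n).natDegree = n := by
  refine Polynomial.natDegree_eq_of_le_of_coeff_ne_zero ?_ ?_
  · rw [Polynomial.natDegree_le_iff_coeff_eq_zero]
    intro k hk
    rw [coeff_jacobiShift, jacobiCoeff_of_lt _ _ hk]
  · rw [coeff_jacobiShift]
    exact jacobiCoeff_self_ne_zero hα hβ n

lemma natDegree_half_mul : (Polynomial.C (1 / 2 : ℝ) * (Polynomial.X - 1)).natDegree = 1 := by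
  rw [Polynomial.natDegree_C_mul (by norm_num)]
  exact Polynomial.natDegree_X_sub_C 1

lemma natDegree_jacobiP (hα : -1 < α) (hβ : -1 < β) (n : ℕ) : (jacobiP α β n).natDegree = n := by
  rw [jacobiP_eq_comp, Polynomial.natDegree_comp, natDegree_jacobiShift hα hβ, natDegree_half_mul,
    mul_one]

lemma jacobiP_ne_zero (hα : -1 < α) (hβ : -1 < β) (n : ℕ) : jacobiP α β n ≠ 0 := by
  rw [jacobiP_eq_comp, ← Polynomial.leadingCoeff_ne_zero,
    Polynomial.leadingCoeff_comp (by rw [natDegree_half_mul]; norm_num)]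
  refine mul_ne_zero ?_ (pow_ne_zero _ ?_)
  · rw [Polynomial.leadingCoeff, natDegree_jacobiShift hα hβ, coeff_jacobiShift]
    exact jacobiCoeff_self_ne_zero hα hβ n
  · rw [Polynomial.leadingCoeff_ne_zero]
    intro h
    have := natDegree_half_mul
    rw [h] at this
    simp at this

lemma integral_mul_add_mul {s t : ℝ} (hs : -1 < s) (ht : -1 < t) (c d : ℝ) (p q : Polynomial ℝ) :
    ∫ x in J, (Polynomial.C c * p + Polynomial.C d * q).eval x * jacobiWeight s t x =
      c * (∫ x in J, p.eval x * jacobiWeight s t x) +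
        d * ∫ x in J, q.eval x * jacobiWeight s t x := by
  rw [← integral_const_mul, ← integral_const_mul, ← integral_add]
  · refine integral_congr_ae (Filter.Eventually.of_forall fun x => ?_)
    simp
    ring
  · exact (integrableOn_eval_mul_jacobiWeight hs ht p).const_mul c
  · exact (integrableOn_eval_mul_jacobiWeight hs ht q).const_mul d

/-- Orthogonality of the Jacobi polynomials. -/
theorem integral_jacobiP_mul_jacobiP (hα : -1 < α) (hβ : -1 < β) {n m : ℕ} (hnm : n ≠ m) :
    ∫ x in J, (jacobiP α β n * jacobiP α β m).eval x * jacobiWeight α β x = 0 := by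
  -- The Wronskian argument: by the differential equation the Pearson operator sends this Wronskian
  -- to the eigenvalue difference times P_n P_m.
  have h := integral_pearsonOp hα hβ (jacobiP α β n * Polynomial.derivative (jacobiP α β m) -
    jacobiP α β m * Polynomial.derivative (jacobiP α β n))
  have hop : pearsonOp α β (jacobiP α β n * Polynomial.derivative (jacobiP α β m) -
      jacobiP α β m * Polynomial.derivative (jacobiP α β n)) =
      Polynomial.C (((n : ℝ) - m) * (n + m + α + β + 1)) * (jacobiP α β n * jacobiP α β m) +
        Polynomial.C 0 * 0 := by
    refine Polynomial.funext fun x => ?_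
    have h1 := jacobiP_ode (α := α) (β := β) n x
    have h2 := jacobiP_ode (α := α) (β := β) m x
    simp only [pearsonOp, Polynomial.eval_add, Polynomial.eval_sub, Polynomial.eval_mul,
      Polynomial.eval_X, Polynomial.eval_C, Polynomial.eval_one, Polynomial.eval_pow,
      Polynomial.derivative_sub, Polynomial.derivative_mul]
    linear_combination (jacobiP α β n).eval x * h2 - (jacobiP α β m).eval x * h1
  rw [hop, integral_mul_add_mul hα hβ, zero_mul, add_zero] at h
  refine (mul_eq_zero.mp h).resolve_left (mul_ne_zero ?_ ?_)
  · rw [sub_ne_zero]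
    exact_mod_cast hnm
  -- Distinct degrees have sum at least 1, which makes n + m + α + β + 1 positive.
  · have : (1 : ℝ) ≤ n + m := by
      have : 1 ≤ n + m := by omega
      exact_mod_cast this
    linarith

lemma jacobiH_eq (n : ℕ) : jacobiH α β n =
    ∫ x in J, (jacobiP α β n * jacobiP α β n).eval x * jacobiWeight α β x := by
  unfold jacobiH jacobiWeight
  simp_rw [Polynomial.eval_mul, sq]

lemma jacobiH_pos (hα : -1 < α) (hβ : -1 < β) (n : ℕ) : 0 < jacobiH α β n := by
  rw [jacobiH_eq]
  have hnn : ∀ x ∈ J, 0 ≤ (jacobiP α β n * jacobiP α β n).eval x * jacobiWeight α β x := by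
    intro x hx
    rw [Polynomial.eval_mul]
    refine mul_nonneg (mul_self_nonneg _) (mul_nonneg ?_ ?_)
    · exact Real.rpow_nonneg (by linarith [hx.2]) _
    · exact Real.rpow_nonneg (by linarith [hx.1]) _
  have hJ : MeasurableSet J := measurableSet_Icc
  rw [setIntegral_pos_iff_support_of_nonneg_ae
    ((ae_restrict_iff' hJ).mpr (Filter.Eventually.of_forall hnn))
    (integrableOn_eval_mul_jacobiWeight hα hβ _)]
  have hsub : Set.Ioo (-1 : ℝ) 1 \ {x | (jacobiP α β n).IsRoot x} ⊆
      Function.support (fun x => (jacobiP α β n * jacobiP α β n).eval x * jacobiWeight α β x) ∩ J := by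
    rintro x ⟨hx, hr⟩
    refine ⟨?_, Set.Ioo_subset_Icc_self hx⟩
    rw [Function.mem_support, Polynomial.eval_mul]
    exact mul_ne_zero (mul_ne_zero hr hr) (jacobiWeight_pos hx).ne'
  refine lt_of_lt_of_le ?_ (measure_mono hsub)
  have hfin : {x | (jacobiP α β n).IsRoot x}.Finite :=
    Polynomial.finite_setOfPred_isRoot (jacobiP_ne_zero hα hβ n)
  rw [measure_sdiff_null (hfin.measure_zero _)]
  simp

/-- Apply `integral_pearsonOp` to P_n P_{n+1}. By the product rule and the recurrence, orthogonality
leaves only the two squared norms. -/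
lemma jacobiH_recurrence (hα : -1 < α) (hβ : -1 < β) (n : ℕ) :
    pearsonUpper α β n * jacobiH α β (n + 1) = pearsonLower α β n * jacobiH α β n := by
  have h := integral_pearsonOp hα hβ (jacobiP α β n * jacobiP α β (n + 1))
  have h02 := integral_jacobiP_mul_jacobiP hα hβ (n := n) (m := n + 2) (by omega)
  rw [pearsonOp_mul, pearsonOp_jacobiP_succ hα hβ] at h
  rcases n with _ | n
  · rw [pearsonOp_jacobiP_zero] at h
    have e : jacobiP α β 0 * (-(Polynomial.C (pearsonUpper α β (0 + 1)) * jacobiP α β (0 + 2)) +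
        Polynomial.C (pearsonLower α β 0) * jacobiP α β 0) +
        jacobiP α β (0 + 1) * -(Polynomial.C (pearsonUpper α β 0) * jacobiP α β 1) =
      Polynomial.C (-pearsonUpper α β 1) * (jacobiP α β 0 * jacobiP α β 2) +
        Polynomial.C 1 * (Polynomial.C (pearsonLower α β 0) * (jacobiP α β 0 * jacobiP α β 0) +
          Polynomial.C (-pearsonUpper α β 0) * (jacobiP α β 1 * jacobiP α β 1)) := by
      simp only [Polynomial.C_neg, Polynomial.C_1]
      ring
    rw [e, integral_mul_add_mul hα hβ, integral_mul_add_mul hα hβ, ← jacobiH_eq, ← jacobiH_eq,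
      h02] at h
    linarith
  · rw [pearsonOp_jacobiP_succ hα hβ] at h
    have h01 := integral_jacobiP_mul_jacobiP hα hβ (n := n + 2) (m := n) (by omega)
    have e : jacobiP α β (n + 1) *
          (-(Polynomial.C (pearsonUpper α β (n + 1 + 1)) * jacobiP α β (n + 1 + 2)) +
            Polynomial.C (pearsonLower α β (n + 1)) * jacobiP α β (n + 1)) +
        jacobiP α β (n + 1 + 1) *
          (-(Polynomial.C (pearsonUpper α β (n + 1)) * jacobiP α β (n + 2)) +
            Polynomial.C (pearsonLower α β n) * jacobiP α β n) =
      Polynomial.C (-pearsonUpper α β (n + 2)) * (jacobiP α β (n + 1) * jacobiP α β (n + 1 + 2)) +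
        Polynomial.C 1 *
        (Polynomial.C (pearsonLower α β n) * (jacobiP α β (n + 2) * jacobiP α β n) +
        Polynomial.C 1 *
        (Polynomial.C (pearsonLower α β (n + 1)) * (jacobiP α β (n + 1) * jacobiP α β (n + 1)) +
          Polynomial.C (-pearsonUpper α β (n + 1)) * (jacobiP α β (n + 2) * jacobiP α β (n + 2)))) := by
      simp only [Polynomial.C_neg, Polynomial.C_1]
      ring
    rw [e, integral_mul_add_mul hα hβ, integral_mul_add_mul hα hβ, integral_mul_add_mul hα hβ,
      ← jacobiH_eq, ← jacobiH_eq, h02, h01] at h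
    linarith

end Orthogonality

end JacobiEnsemble

namespace JacobiEnsemble

/-! ### The operator ε as an antisymmetric inverse of differentiation. -/

section Epsilon

lemma measurableSet_J : MeasurableSet J := measurableSet_Icc

lemma isCompact_J : IsCompact J := isCompact_Icc

lemma ae_J_of_forall {P : ℝ → Prop} (h : ∀ x ∈ J, P x) : ∀ᵐ x ∂(volume.restrict J), P x :=
  (ae_restrict_iff' measurableSet_J).mpr (Filter.Eventually.of_forall h)

lemma integrable_eps_mul {g : ℝ → ℂ} (hg : IntegrableOn g J) (x : ℝ) :
    IntegrableOn (fun y => eps x y * g y) J :=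
  hg.bdd_mul (c := 1) (measurable_eps.comp measurable_prodMk_left).aestronglyMeasurable
    (Filter.Eventually.of_forall fun y => norm_eps_le x y)

lemma integral_mul_eps (g : ℝ → ℂ) (y : ℝ) :
    ∫ x in J, g x * eps x y = -applyFun eps g y := by
  unfold applyFun
  rw [← integral_neg]
  refine integral_congr_ae (Filter.Eventually.of_forall fun x => ?_)
  simp only
  rw [eps_swap x y]
  ring

lemma applyFun_eps_congr {g h : ℝ → ℂ} (hgh : ∀ x ∈ J, g x = h x) (x : ℝ) :
    applyFun eps g x = applyFun eps h x :=
  integral_congr_ae (ae_J_of_forall fun y hy => by simp only [hgh y hy])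

lemma applyFun_eps_add {g h : ℝ → ℂ} (hg : IntegrableOn g J) (hh : IntegrableOn h J) (x : ℝ) :
    applyFun eps (fun y => g y + h y) x = applyFun eps g x + applyFun eps h x := by
  unfold applyFun
  simp_rw [mul_add]
  exact integral_add (integrable_eps_mul hg x) (integrable_eps_mul hh x)

lemma applyFun_eps_const_mul (c : ℂ) (g : ℝ → ℂ) (x : ℝ) :
    applyFun eps (fun y => c * g y) x = c * applyFun eps g x := by
  unfold applyFun
  rw [← integral_const_mul]
  refine integral_congr_ae (Filter.Eventually.of_forall fun y => ?_)
  simp only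
  ring

/-- The kernel is 1/2 below x and -1/2 above, so εg is the primitive from -1 minus half the total
integral. -/
lemma applyFun_eps_eq {g : ℝ → ℂ} (hg : IntegrableOn g J) {x : ℝ} (hx : x ∈ J) :
    applyFun eps g x = (∫ y in (-1 : ℝ)..x, g y) - (∫ y in (-1 : ℝ)..1, g y) / 2 := by
  have hI : ∀ c d : ℝ, c ∈ J → d ∈ J → IntervalIntegrable g volume c d := by
    intro c d hc hd
    have : IntervalIntegrable g volume (-1) 1 := by
      rw [intervalIntegrable_iff_integrableOn_Icc_of_le (by norm_num)]
      exact hg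
    refine this.mono_set ?_
    rw [Set.uIcc_of_le (by norm_num : (-1 : ℝ) ≤ 1)]
    exact Set.uIcc_subset_Icc hc hd
  have hm : (-1 : ℝ) ∈ J := ⟨le_rfl, by norm_num⟩
  have hp : (1 : ℝ) ∈ J := ⟨by norm_num, le_rfl⟩
  have hE : ∀ c d : ℝ, c ∈ J → d ∈ J → IntervalIntegrable (fun y => eps x y * g y) volume c d := by
    intro c d hc hd
    have : IntervalIntegrable (fun y => eps x y * g y) volume (-1) 1 := by
      rw [intervalIntegrable_iff_integrableOn_Icc_of_le (by norm_num)]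
      exact integrable_eps_mul hg x
    refine this.mono_set ?_
    rw [Set.uIcc_of_le (by norm_num : (-1 : ℝ) ≤ 1)]
    exact Set.uIcc_subset_Icc hc hd
  have h1 : applyFun eps g x = ∫ y in (-1 : ℝ)..1, eps x y * g y := by
    unfold applyFun
    rw [intervalIntegral.integral_of_le (by norm_num), ← integral_Icc_eq_integral_Ioc]
    rfl
  have h2 : ∫ y in (-1 : ℝ)..x, eps x y * g y = 1 / 2 * ∫ y in (-1 : ℝ)..x, g y := by
    rw [← intervalIntegral.integral_const_mul, intervalIntegral.integral_of_le hx.1,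
      intervalIntegral.integral_of_le hx.1, integral_Ioc_eq_integral_Ioo,
      integral_Ioc_eq_integral_Ioo]
    refine setIntegral_congr_fun measurableSet_Ioo fun y hy => ?_
    rw [eps_eq_of_gt hy.2]
  have h3 : ∫ y in x..1, eps x y * g y = -1 / 2 * ∫ y in x..1, g y := by
    rw [← intervalIntegral.integral_const_mul, intervalIntegral.integral_of_le hx.2,
      intervalIntegral.integral_of_le hx.2]
    refine setIntegral_congr_fun measurableSet_Ioc fun y hy => ?_
    rw [eps_eq_of_lt hy.1]
  rw [h1, ← intervalIntegral.integral_add_adjacent_intervals (hE _ _ hm hx) (hE _ _ hx hp), h2, h3,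
    ← intervalIntegral.integral_add_adjacent_intervals (hI _ _ hm hx) (hI _ _ hx hp)]
  ring

lemma continuousOn_applyFun_eps {g : ℝ → ℂ} (hg : IntegrableOn g J) :
    ContinuousOn (applyFun eps g) J := by
  have h : ContinuousOn (fun x => (∫ y in (-1 : ℝ)..x, g y) - (∫ y in (-1 : ℝ)..1, g y) / 2) J := by
    refine ContinuousOn.sub ?_ continuousOn_const
    have := intervalIntegral.continuousOn_primitive_interval (f := g) (a := -1) (b := 1)
      (μ := volume) (by rwa [Set.uIcc_of_le (by norm_num : (-1 : ℝ) ≤ 1)])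
    rwa [Set.uIcc_of_le (by norm_num : (-1 : ℝ) ≤ 1)] at this
  exact h.congr fun x hx => applyFun_eps_eq hg hx

lemma hasDerivAt_applyFun_eps {g : ℝ → ℂ} (hg : IntegrableOn g J)
    (hc : ContinuousOn g (Set.Ioo (-1) 1)) {x : ℝ} (hx : x ∈ Set.Ioo (-1 : ℝ) 1) :
    HasDerivAt (applyFun eps g) (g x) x := by
  have hII : IntervalIntegrable g volume (-1) x := by
    rw [intervalIntegrable_iff_integrableOn_Icc_of_le hx.1.le]
    exact hg.mono_set (Set.Icc_subset_Icc_right hx.2.le)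
  have h := (intervalIntegral.integral_hasDerivAt_right hII
    (hc.stronglyMeasurableAtFilter isOpen_Ioo x hx)
    (hc.continuousAt (Ioo_mem_nhds hx.1 hx.2))).sub_const ((∫ y in (-1 : ℝ)..1, g y) / 2)
  refine h.congr_of_eventuallyEq ?_
  filter_upwards [Ioo_mem_nhds hx.1 hx.2] with z hz
  exact applyFun_eps_eq hg (Set.Ioo_subset_Icc_self hz)

/-- `ε` inverts differentiation on functions vanishing at the endpoints. -/
lemma applyFun_eps_deriv {u g : ℝ → ℂ} (hu : ContinuousOn u J)
    (hd : ∀ x ∈ Set.Ioo (-1 : ℝ) 1, HasDerivAt u (g x) x) (hg : IntegrableOn g J)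
    (hl : u (-1) = 0) (hr : u 1 = 0) {x : ℝ} (hx : x ∈ J) : applyFun eps g x = u x := by
  have key : ∀ y ∈ J, ∫ z in (-1 : ℝ)..y, g z = u y := by
    intro y hy
    rw [intervalIntegral.integral_eq_sub_of_hasDerivAt_of_le hy.1
      (hu.mono (Set.Icc_subset_Icc_right hy.2))
      (fun z hz => hd z ⟨hz.1, hz.2.trans_le hy.2⟩), hl, sub_zero]
    rw [intervalIntegrable_iff_integrableOn_Icc_of_le hy.1]
    exact hg.mono_set (Set.Icc_subset_Icc_right hy.2)
  rw [applyFun_eps_eq hg hx, key x hx, key 1 ⟨by norm_num, le_rfl⟩, hr]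
  simp

lemma integral_mul_applyFun_eps {g h : ℝ → ℂ} (hg : IntegrableOn g J) (hh : IntegrableOn h J) :
    skewForm g h = ∫ x in J, g x * applyFun eps h x := by
  unfold skewForm applyFun
  rw [integral_prod _ (integrable_mul_eps_mul hg hh)]
  refine integral_congr_ae (Filter.Eventually.of_forall fun x => ?_)
  simp only
  rw [← integral_const_mul]
  simp_rw [mul_assoc]

lemma skewForm_swap (g h : ℝ → ℂ) : skewForm g h = -skewForm h g := by
  unfold skewForm
  rw [← integral_prod_swap, ← integral_neg]
  refine integral_congr_ae (Filter.Eventually.of_forall fun p => ?_)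
  simp only [Prod.fst_swap, Prod.snd_swap]
  rw [eps_swap p.2 p.1]
  ring

lemma integral_mul_applyFun_eps_swap {g h : ℝ → ℂ} (hg : IntegrableOn g J) (hh : IntegrableOn h J) :
    ∫ x in J, g x * applyFun eps h x = -∫ x in J, applyFun eps g x * h x := by
  rw [← integral_mul_applyFun_eps hg hh, skewForm_swap, integral_mul_applyFun_eps hh hg]
  simp_rw [mul_comm]

lemma skewForm_sum_right {ι : Type*} (s : Finset ι) (c : ι → ℂ) (g : ℝ → ℂ) (h : ι → ℝ → ℂ)
    (hg : IntegrableOn g J) (hh : ∀ i, IntegrableOn (h i) J) :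
    skewForm g (fun x => ∑ i ∈ s, c i * h i x) = ∑ i ∈ s, skewForm g (h i) * c i := by
  unfold skewForm
  simp_rw [← integral_mul_const]
  rw [← integral_finsetSum _ fun i _ => (integrable_mul_eps_mul hg (hh i)).mul_const _]
  refine integral_congr_ae (Filter.Eventually.of_forall fun p => ?_)
  simp only
  rw [Finset.mul_sum]
  exact Finset.sum_congr rfl fun i _ => by ring

end Epsilon

/-! ### Effect of the factor 1 + f on the skew form. -/

section Perturbation

variable {f : ℝ → ℂ} (hf : ContDiffOn ℝ 1 f (Set.Icc (-1) 1))

include hf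

lemma continuousOn_derivWithin_J : ContinuousOn (derivWithin f J) J :=
  hf.continuousOn_derivWithin (uniqueDiffOn_Icc (by norm_num)) le_rfl

lemma hasDerivAt_of_mem_Ioo {x : ℝ} (hx : x ∈ Set.Ioo (-1 : ℝ) 1) :
    HasDerivAt f (derivWithin f J x) x :=
  ((hf.differentiableOn one_ne_zero x (Set.Ioo_subset_Icc_self hx)).hasDerivWithinAt).hasDerivAt
    (Icc_mem_nhds hx.1 hx.2)

/-- Integration by parts: f · εg has derivative f' · εg + f g and vanishes at ±1 because f does, so
ε recovers it from that derivative. -/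
lemma applyFun_eps_mul (hl : f (-1) = 0) (hr : f 1 = 0) {g : ℝ → ℂ} (hg : IntegrableOn g J)
    (hc : ContinuousOn g (Set.Ioo (-1) 1)) {x : ℝ} (hx : x ∈ J) :
    applyFun eps (fun y => f y * g y) x = f x * applyFun eps g x -
      applyFun eps (fun y => derivWithin f J y * applyFun eps g y) x := by
  have hfg : IntegrableOn (fun y => f y * g y) J := hg.continuousOn_mul hf.continuousOn isCompact_J
  have hfe : IntegrableOn (fun y => derivWithin f J y * applyFun eps g y) J :=
    ((continuousOn_derivWithin_J hf).mul (continuousOn_applyFun_eps hg)).integrableOn_compact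
      isCompact_J
  rw [eq_sub_iff_add_eq, add_comm, ← applyFun_eps_add hfe hfg]
  refine applyFun_eps_deriv (u := fun y => f y * applyFun eps g y)
    (hf.continuousOn.mul (continuousOn_applyFun_eps hg)) ?_ (hfe.add hfg) (by simp [hl])
    (by simp [hr]) hx
  intro y hy
  exact (hasDerivAt_of_mem_Ioo hf hy).mul (hasDerivAt_applyFun_eps hg hc hy)

/-- The function `y ↦ (φ (f² + 2f - ε f' - f ε f'))(y)` obtained by letting the operator act to
the left. -/
noncomputable def leftFactor (f φ : ℝ → ℂ) (y : ℝ) : ℂ :=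
  φ y * (f y ^ 2 + 2 * f y) +
    (applyFun eps φ y + applyFun eps (fun z => φ z * f z) y) * derivWithin f J y

lemma integrableOn_mul_left {φ : ℝ → ℂ} (hφ : IntegrableOn φ J) :
    IntegrableOn (fun z => φ z * f z) J := hφ.mul_continuousOn hf.continuousOn isCompact_J

lemma integrableOn_leftFactor {φ : ℝ → ℂ} (hφ : IntegrableOn φ J) :
    IntegrableOn (leftFactor f φ) J := by
  have hfc := hf.continuousOn
  refine Integrable.add ?_ ?_
  · exact hφ.mul_continuousOn ((hfc.pow 2).add (continuousOn_const.mul hfc)) isCompact_J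
  · exact (((continuousOn_applyFun_eps hφ).add (continuousOn_applyFun_eps
      (integrableOn_mul_left hf hφ))).mul (continuousOn_derivWithin_J hf)).integrableOn_compact
      isCompact_J

/-- Commute ε past 1 + f, then move the remaining outer ε onto φ(1+f) by antisymmetry. Everything
now multiplies εg, and the excess over φ is `leftFactor`, using (1+f)² - 1 = f² + 2f. -/
theorem skewForm_one_add_mul (hl : f (-1) = 0) (hr : f 1 = 0) {φ g : ℝ → ℂ}
    (hφ : IntegrableOn φ J) (hg : IntegrableOn g J) (hc : ContinuousOn g (Set.Ioo (-1) 1)) :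
    skewForm (fun x => φ x * (1 + f x)) (fun x => g x * (1 + f x)) =
      skewForm φ g + ∫ y in J, leftFactor f φ y * applyFun eps g y := by
  have hfc : ContinuousOn f J := hf.continuousOn
  have h1f : ContinuousOn (fun x => 1 + f x) J := continuousOn_const.add hfc
  have hφf : IntegrableOn (fun x => φ x * (1 + f x)) J := hφ.mul_continuousOn h1f isCompact_J
  have hgf : IntegrableOn (fun x => g x * (1 + f x)) J := hg.mul_continuousOn h1f isCompact_J
  have hu := continuousOn_applyFun_eps hg
  have hfu : IntegrableOn (fun y => derivWithin f J y * applyFun eps g y) J :=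
    ((continuousOn_derivWithin_J hf).mul hu).integrableOn_compact isCompact_J
  have hE : ∀ x ∈ J, applyFun eps (fun y => g y * (1 + f y)) x =
      (1 + f x) * applyFun eps g x -
        applyFun eps (fun y => derivWithin f J y * applyFun eps g y) x := by
    intro x hx
    have h1 := applyFun_eps_add hg (hg.continuousOn_mul hfc isCompact_J) x
    rw [applyFun_eps_mul hf hl hr hg hc hx] at h1
    rw [applyFun_eps_congr (h := fun y => g y + f y * g y) (fun y _ => by ring), h1]
    ring
  have hEφ : ∀ x, applyFun eps (fun y => φ y * (1 + f y)) x =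
      applyFun eps φ x + applyFun eps (fun z => φ z * f z) x := by
    intro x
    rw [← applyFun_eps_add hφ (integrableOn_mul_left hf hφ)]
    exact applyFun_eps_congr (fun y _ => by ring) x
  have hfub := integral_mul_applyFun_eps_swap hφf hfu
  rw [integral_mul_applyFun_eps hφf hgf, integral_mul_applyFun_eps hφ hg]
  have hstep : ∫ x in J, φ x * (1 + f x) * applyFun eps (fun y => g y * (1 + f y)) x =
      (∫ x in J, φ x * (1 + f x) * ((1 + f x) * applyFun eps g x)) -
        ∫ x in J, φ x * (1 + f x) *
          applyFun eps (fun y => derivWithin f J y * applyFun eps g y) x := by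
    rw [← integral_sub]
    · refine integral_congr_ae (ae_J_of_forall fun x hx => ?_)
      simp only
      rw [hE x hx]
      ring
    · exact hφf.mul_continuousOn (h1f.mul hu) isCompact_J
    · exact hφf.mul_continuousOn (continuousOn_applyFun_eps hfu) isCompact_J
  rw [hstep, hfub, sub_neg_eq_add, ← integral_add, ← integral_add]
  · refine integral_congr_ae (Filter.Eventually.of_forall fun x => ?_)
    simp only [leftFactor, hEφ]
    ring
  · exact hφ.mul_continuousOn hu isCompact_J
  · exact (integrableOn_leftFactor hf hφ).mul_continuousOn hu isCompact_J
  · exact hφf.mul_continuousOn (h1f.mul hu) isCompact_J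
  · exact hfu.continuousOn_mul (continuousOn_applyFun_eps hφf) isCompact_J

end Perturbation

end JacobiEnsemble

namespace JacobiEnsemble

/-! ### Orthonormal functions and the skew matrix of differentiation. -/

section Orthonormal

variable (a b : ℝ)

/-- The orthonormal Jacobi polynomial `P_j^{(a+1,b+1)} / √h_j^{(a+1,b+1)}`. -/
noncomputable def normP (j : ℕ) : Polynomial ℝ :=
  Polynomial.C (1 / √(jacobiH (a + 1) (b + 1) j)) * jacobiP (a + 1) (b + 1) j

/-- The coefficient in `((1-x²) φ_j)' = -d_j φ_{j+1} + d_{j-1} φ_{j-1}`. -/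
noncomputable def skewCoeff (j : ℕ) : ℝ :=
  pearsonUpper (a + 1) (b + 1) j * √(jacobiH (a + 1) (b + 1) (j + 1)) /
    √(jacobiH (a + 1) (b + 1) j)

lemma phi_eq (j : ℕ) (x : ℝ) :
    phi a b j x = (((normP a b j).eval x * jacobiWeight (a / 2) (b / 2) x : ℝ) : ℂ) := by
  simp only [phi, normP, weight, jacobiWeight, Polynomial.eval_mul, Polynomial.eval_C]
  congr 2
  ring

lemma pearsonOp_C_mul (s t c : ℝ) (p : Polynomial ℝ) :
    pearsonOp s t (Polynomial.C c * p) = Polynomial.C c * pearsonOp s t p := by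
  unfold pearsonOp
  rw [Polynomial.derivative_C_mul]
  ring

variable {a b}

lemma integrableOn_phi (ha : -2 < a) (hb : -2 < b) (j : ℕ) : IntegrableOn (phi a b j) J := by
  have := (integrableOn_eval_mul_jacobiWeight (s := a / 2) (t := b / 2) (by linarith) (by linarith)
    (normP a b j)).ofReal (𝕜 := ℂ)
  exact this.congr (Filter.Eventually.of_forall fun x => (phi_eq a b j x).symm)

lemma continuousOn_phi (j : ℕ) : ContinuousOn (phi a b j) (Set.Ioo (-1) 1) := by
  have h : ContinuousOn (fun x => (((normP a b j).eval x * jacobiWeight (a / 2) (b / 2) x : ℝ) : ℂ))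
      (Set.Ioo (-1) 1) :=
    Complex.continuous_ofReal.comp_continuousOn
      ((normP a b j).continuous.continuousOn.mul continuousOn_jacobiWeight)
  exact h.congr fun x _ => phi_eq a b j x

lemma skewCoeff_sq (ha : -2 < a) (hb : -2 < b) (j : ℕ) :
    skewCoeff a b j ^ 2 = pearsonUpper (a + 1) (b + 1) j * pearsonLower (a + 1) (b + 1) j := by
  have h1 := jacobiH_pos (α := a + 1) (β := b + 1) (by linarith) (by linarith) j
  have h2 := jacobiH_pos (α := a + 1) (β := b + 1) (by linarith) (by linarith) (j + 1)
  have h := jacobiH_recurrence (α := a + 1) (β := b + 1) (by linarith) (by linarith) j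
  unfold skewCoeff
  rw [div_pow, mul_pow, Real.sq_sqrt h1.le, Real.sq_sqrt h2.le, div_eq_iff h1.ne']
  linear_combination pearsonUpper (a + 1) (b + 1) j * h

/-- C_N is the recurrence coefficient coupling φ_{N-1} to φ_N. Starting at N = 2 avoids the
exceptional upper coefficient at index 0. -/
lemma C_eq_skewCoeff (ha : -2 < a) (hb : -2 < b) (n : ℕ) : C a b (n + 2) = skewCoeff a b (n + 1) := by
  have hn : (0 : ℝ) ≤ n := n.cast_nonneg
  have h0 : 0 ≤ skewCoeff a b (n + 1) := by
    unfold skewCoeff pearsonUpper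
    refine div_nonneg (mul_nonneg (div_nonneg (mul_nonneg ?_ ?_) ?_) (Real.sqrt_nonneg _))
      (Real.sqrt_nonneg _) <;> linarith
  rw [← Real.sqrt_sq h0, skewCoeff_sq ha hb]
  unfold C pearsonUpper pearsonLower
  congr 1
  push_cast
  have d1 : 2 * ((n : ℝ) + 2) + a + b + 1 ≠ 0 := by linarith
  have d2 : 2 * ((n : ℝ) + 2) + a + b + 3 ≠ 0 := by linarith
  have d3 : 2 * (n : ℝ) + (a + 1) + (b + 1) + 3 ≠ 0 := by linarith
  have d4 : 2 * ((n : ℝ) + 1) + (a + 1) + (b + 1) + 3 ≠ 0 := by linarith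
  rw [div_mul_div_comm, div_eq_div_iff (mul_ne_zero d1 d2) (mul_ne_zero d3 d4)]
  ring

lemma pearsonOp_normP_zero (ha : -2 < a) (hb : -2 < b) :
    pearsonOp (a / 2) (b / 2) (normP a b 0) = -(Polynomial.C (skewCoeff a b 0) * normP a b 1) := by
  have h0 := Real.sqrt_pos.mpr
    (jacobiH_pos (α := a + 1) (β := b + 1) (by linarith) (by linarith) 0)
  have h1 := Real.sqrt_pos.mpr
    (jacobiH_pos (α := a + 1) (β := b + 1) (by linarith) (by linarith) 1)
  have h := pearsonOp_jacobiP_zero (α := a + 1) (β := b + 1)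
  rw [add_sub_cancel_right, add_sub_cancel_right] at h
  unfold normP
  rw [pearsonOp_C_mul, h]
  refine Polynomial.funext fun x => ?_
  simp only [Polynomial.eval_mul, Polynomial.eval_neg, Polynomial.eval_C, skewCoeff, zero_add]
  field_simp

/-- The norm recurrence identifies the normalized lower coefficient at n + 1 with the upper one at
n; this is the source of skew-symmetry. -/
lemma pearsonOp_normP_succ (ha : -2 < a) (hb : -2 < b) (n : ℕ) :
    pearsonOp (a / 2) (b / 2) (normP a b (n + 1)) =
      -(Polynomial.C (skewCoeff a b (n + 1)) * normP a b (n + 2)) +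
        Polynomial.C (skewCoeff a b n) * normP a b n := by
  have p0 := jacobiH_pos (α := a + 1) (β := b + 1) (by linarith) (by linarith) n
  have p1 := jacobiH_pos (α := a + 1) (β := b + 1) (by linarith) (by linarith) (n + 1)
  have p2 := jacobiH_pos (α := a + 1) (β := b + 1) (by linarith) (by linarith) (n + 2)
  have hrec := jacobiH_recurrence (α := a + 1) (β := b + 1) (by linarith) (by linarith) n
  have h := pearsonOp_jacobiP_succ (α := a + 1) (β := b + 1) (by linarith) (by linarith) n
  rw [add_sub_cancel_right, add_sub_cancel_right] at h
  rw [← Real.sq_sqrt p0.le, ← Real.sq_sqrt p1.le] at hrec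
  replace p0 := Real.sqrt_pos.mpr p0
  replace p1 := Real.sqrt_pos.mpr p1
  replace p2 := Real.sqrt_pos.mpr p2
  unfold normP
  rw [pearsonOp_C_mul, h]
  refine Polynomial.funext fun x => ?_
  simp only [Polynomial.eval_mul, Polynomial.eval_neg, Polynomial.eval_add, Polynomial.eval_C,
    skewCoeff]
  set r0 := √(jacobiH (a + 1) (b + 1) n)
  set r1 := √(jacobiH (a + 1) (b + 1) (n + 1))
  set r2 := √(jacobiH (a + 1) (b + 1) (n + 2))
  set U := pearsonUpper (a + 1) (b + 1) n
  set V := pearsonLower (a + 1) (b + 1) n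
  have e1 : 1 / r1 * V = U * r1 / r0 * (1 / r0) := by
    field_simp
    linear_combination -hrec
  have e2 : 1 / r1 * pearsonUpper (a + 1) (b + 1) (n + 1) =
      pearsonUpper (a + 1) (b + 1) (n + 1) * r2 / r1 * (1 / r2) := by
    field_simp
  linear_combination (jacobiP (a + 1) (b + 1) n).eval x * e1 -
    (jacobiP (a + 1) (b + 1) (n + 2)).eval x * e2

/-- The product (1-x²)w² is the weight with exponents a + 1, b + 1, so Jacobi orthonormality becomes
biorthogonality of φ_i and (1-x²)φ_j. -/
lemma integral_one_sub_sq_mul_phi_mul_phi (ha : -2 < a) (hb : -2 < b) (i j : ℕ) :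
    ∫ x in J, phi a b i x * ((1 - (x : ℂ) ^ 2) * phi a b j x) = if i = j then 1 else 0 := by
  have hα : -1 < a + 1 := by linarith
  have hβ : -1 < b + 1 := by linarith
  have h1 : ∀ x ∈ Set.Ioo (-1 : ℝ) 1, phi a b i x * ((1 - (x : ℂ) ^ 2) * phi a b j x) =
      ((1 / √(jacobiH (a + 1) (b + 1) i) * (1 / √(jacobiH (a + 1) (b + 1) j)) *
        ((jacobiP (a + 1) (b + 1) i * jacobiP (a + 1) (b + 1) j).eval x *
          jacobiWeight (a + 1) (b + 1) x) : ℝ) : ℂ) := by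
    intro x hx
    have hw : (1 - x ^ 2) * (jacobiWeight (a / 2) (b / 2) x * jacobiWeight (a / 2) (b / 2) x) =
        jacobiWeight (a + 1) (b + 1) x := by
      have p1 : (0 : ℝ) < 1 - x := by linarith [hx.2]
      have p2 : (0 : ℝ) < 1 + x := by linarith [hx.1]
      unfold jacobiWeight
      rw [Real.rpow_add_one p1.ne', Real.rpow_add_one p2.ne',
        show (1 - x) ^ a = (1 - x) ^ (a / 2) * (1 - x) ^ (a / 2) by
          rw [← Real.rpow_add p1]; congr 1; ring,
        show (1 + x) ^ b = (1 + x) ^ (b / 2) * (1 + x) ^ (b / 2) by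
          rw [← Real.rpow_add p2]; congr 1; ring]
      ring
    rw [phi_eq, phi_eq, ← hw]
    simp only [normP, Polynomial.eval_mul, Polynomial.eval_C]
    push_cast
    ring
  have h2 : ∫ x in J, phi a b i x * ((1 - (x : ℂ) ^ 2) * phi a b j x) =
      ((∫ x in J, 1 / √(jacobiH (a + 1) (b + 1) i) * (1 / √(jacobiH (a + 1) (b + 1) j)) *
        ((jacobiP (a + 1) (b + 1) i * jacobiP (a + 1) (b + 1) j).eval x *
          jacobiWeight (a + 1) (b + 1) x) : ℝ) : ℂ) := by
    unfold J
    rw [integral_Icc_eq_integral_Ioo, integral_Icc_eq_integral_Ioo, ← integral_complex_ofReal]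
    exact setIntegral_congr_fun measurableSet_Ioo h1
  rw [h2, integral_const_mul]
  split_ifs with h
  · subst h
    rw [← jacobiH_eq]
    have hp := jacobiH_pos hα hβ i
    have hs := Real.mul_self_sqrt hp.le
    have hs0 := Real.sqrt_pos.mpr hp
    rw [show 1 / √(jacobiH (a + 1) (b + 1) i) * (1 / √(jacobiH (a + 1) (b + 1) i)) *
      jacobiH (a + 1) (b + 1) i = 1 by
        nth_rewrite 3 [← hs]
        field_simp]
    simp
  · rw [integral_jacobiP_mul_jacobiP hα hβ h]
    simp

lemma continuousOn_one_sub_sq_mul_phi (ha : -2 < a) (hb : -2 < b) (j : ℕ) :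
    ContinuousOn (fun x : ℝ => (1 - (x : ℂ) ^ 2) * phi a b j x) J := by
  have h := Complex.continuous_ofReal.comp_continuousOn
    (continuousOn_one_sub_sq_mul (s := a / 2) (t := b / 2) (by linarith) (by linarith)
      (normP a b j))
  refine h.congr fun x _ => ?_
  simp [phi_eq]

lemma hasDerivAt_one_sub_sq_mul_phi (j : ℕ) {x : ℝ} (hx : x ∈ Set.Ioo (-1 : ℝ) 1) :
    HasDerivAt (fun x : ℝ => (1 - (x : ℂ) ^ 2) * phi a b j x)
      (((pearsonOp (a / 2) (b / 2) (normP a b j)).eval x * jacobiWeight (a / 2) (b / 2) x : ℝ) : ℂ)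
      x := by
  have h := (hasDerivAt_one_sub_sq_mul (s := a / 2) (t := b / 2) (normP a b j) hx).ofReal_comp
  refine h.congr_of_eventuallyEq (Filter.Eventually.of_forall fun x => ?_)
  simp [phi_eq]

/-- The matrix of `g ↦ ((1-x²) g)'` on the span of `φ_0, …, φ_{N-1}`, compressed to that span. -/
noncomputable def skewMatrix (a b : ℝ) (N : ℕ) : Matrix (Fin N) (Fin N) ℂ :=
  Matrix.of fun j k => if (j : ℕ) = k + 1 then -(skewCoeff a b k : ℂ)
    else if (k : ℕ) = j + 1 then (skewCoeff a b j : ℂ) else 0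

lemma skewMatrix_transpose (N : ℕ) : (skewMatrix a b N).transpose = -skewMatrix a b N := by
  ext j k
  simp only [skewMatrix, Matrix.transpose_apply, Matrix.of_apply, Matrix.neg_apply]
  by_cases h1 : (j : ℕ) = k + 1
  · have h2 : (k : ℕ) ≠ j + 1 := by omega
    rw [if_neg h2, if_pos h1, if_pos h1, neg_neg]
  · by_cases h2 : (k : ℕ) = j + 1
    · rw [if_pos h2, if_neg h1, if_pos h2]
    · rw [if_neg h2, if_neg h1, if_neg h1, if_neg h2, neg_zero]

lemma sum_skewMatrix_mul {N : ℕ} (F : ℕ → ℂ) (k : Fin N) :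
    ∑ j : Fin N, skewMatrix a b N j k * F j =
      (if (k : ℕ) + 1 < N then -(skewCoeff a b k : ℂ) * F (k + 1) else 0) +
        if (k : ℕ) = 0 then 0 else (skewCoeff a b (k - 1) : ℂ) * F (k - 1) := by
  -- For k = 0 the truncated index k - 1 selects j = 0, where the inner conditional supplies 0.
  have hsplit : ∀ j : Fin N, skewMatrix a b N j k * F j =
      (if (j : ℕ) = k + 1 then -(skewCoeff a b k : ℂ) * F (k + 1) else 0) +
        if (j : ℕ) = k - 1 then
          (if (k : ℕ) = 0 then 0 else (skewCoeff a b (k - 1) : ℂ) * F (k - 1)) else 0 := by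
    intro j
    simp only [skewMatrix, Matrix.of_apply]
    by_cases h1 : (j : ℕ) = k + 1
    · rw [if_pos h1, if_pos h1, if_neg (by omega), h1, add_zero]
    · rw [if_neg h1, if_neg h1, zero_add]
      by_cases h2 : (k : ℕ) = j + 1
      · rw [if_pos h2, if_pos (by omega), if_neg (by omega), h2, Nat.add_sub_cancel]
      · rw [if_neg h2, zero_mul]
        by_cases h3 : (j : ℕ) = k - 1
        · rw [if_pos h3, if_pos (by omega)]
        · rw [if_neg h3]
  simp_rw [hsplit]
  rw [Finset.sum_add_distrib]
  congr 1
  · split_ifs with h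
    · rw [Finset.sum_eq_single ⟨k + 1, h⟩]
      · simp
      · intro j _ hj
        exact if_neg fun h' => hj (Fin.ext h')
      · simp
    · exact Finset.sum_eq_zero fun j _ => if_neg (by have := j.2; omega)
  · have hk : (k : ℕ) - 1 < N := by have := k.2; omega
    rw [Finset.sum_eq_single ⟨k - 1, hk⟩]
    · simp
    · intro j _ hj
      exact if_neg fun h' => hj (Fin.ext h')
    · simp

/-- The combination `∑_j D_{jk} φ_j`. -/
noncomputable def skewImage (a b : ℝ) (N : ℕ) (k : Fin N) (x : ℝ) : ℂ :=
  ∑ j : Fin N, skewMatrix a b N j k * phi a b j x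

/-- Truncating at N loses only the φ_N term, which occurs in the last column alone. -/
lemma deriv_eq_skewImage_sub (ha : -2 < a) (hb : -2 < b) {N : ℕ} (k : Fin N) (x : ℝ) :
    (((pearsonOp (a / 2) (b / 2) (normP a b k)).eval x * jacobiWeight (a / 2) (b / 2) x : ℝ) : ℂ) =
      skewImage a b N k x -
        if (k : ℕ) + 1 = N then (skewCoeff a b k : ℂ) * phi a b N x else 0 := by
  unfold skewImage
  rw [sum_skewMatrix_mul (fun j => phi a b j x)]
  have hup : (if (k : ℕ) + 1 < N then -(skewCoeff a b k : ℂ) * phi a b (k + 1) x else 0) -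
      (if (k : ℕ) + 1 = N then (skewCoeff a b k : ℂ) * phi a b N x else 0) =
      -(skewCoeff a b k : ℂ) * phi a b (k + 1) x := by
    rcases Nat.lt_or_eq_of_le (Nat.succ_le_of_lt k.2) with h | h
    · rw [if_pos h, if_neg (by omega), sub_zero]
    · rw [if_neg (by omega), if_pos h, show phi a b N = phi a b (k + 1) from congrArg (phi a b) h.symm]
      ring
  rw [add_sub_right_comm, hup]
  rcases hk : (k : ℕ) with _ | n
  · rw [pearsonOp_normP_zero ha hb, phi_eq]
    simp
    ring
  · rw [pearsonOp_normP_succ ha hb, phi_eq, if_neg (by omega), Nat.add_sub_cancel, phi_eq]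
    simp
    ring

lemma integrableOn_skewImage (ha : -2 < a) (hb : -2 < b) {N : ℕ} (k : Fin N) :
    IntegrableOn (skewImage a b N k) J :=
  integrable_finsetSum _ fun j _ => (integrableOn_phi ha hb j).const_mul _

lemma continuousOn_skewImage {N : ℕ} (k : Fin N) :
    ContinuousOn (skewImage a b N k) (Set.Ioo (-1) 1) :=
  continuousOn_finsetSum _ fun j _ => continuousOn_const.mul (continuousOn_phi j)

/-- The function `(1-x²) φ_k`, corrected by a multiple of `ε φ_N` when `k = N - 1`; it is the image
under `ε` of `∑_j D_{jk} φ_j` and the factor in `x` of the finite rank kernel `T`. -/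
noncomputable def rightFactor (a b : ℝ) (N : ℕ) (k : Fin N) (x : ℝ) : ℂ :=
  (1 - (x : ℂ) ^ 2) * phi a b k x +
    if (k : ℕ) + 1 = N then (skewCoeff a b k : ℂ) * applyFun eps (phi a b N) x else 0

/-- The function (1-x²)φ_k is continuous and vanishes at ±1, so ε recovers it from its derivative;
the truncation term gives the multiple of εφ_N. -/
lemma applyFun_eps_skewImage (ha : -2 < a) (hb : -2 < b) {N : ℕ} (k : Fin N) {x : ℝ} (hx : x ∈ J) :
    applyFun eps (skewImage a b N k) x = rightFactor a b N k x := by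
  set g : ℝ → ℂ := fun x => (((pearsonOp (a / 2) (b / 2) (normP a b k)).eval x *
    jacobiWeight (a / 2) (b / 2) x : ℝ) : ℂ) with hg
  have hgi : IntegrableOn g J := (integrableOn_eval_mul_jacobiWeight (s := a / 2) (t := b / 2)
    (by linarith) (by linarith) _).ofReal
  have hEg : applyFun eps g x = (1 - (x : ℂ) ^ 2) * phi a b k x :=
    applyFun_eps_deriv (continuousOn_one_sub_sq_mul_phi ha hb k)
      (fun y hy => hasDerivAt_one_sub_sq_mul_phi k hy) hgi (by simp) (by simp) hx
  unfold rightFactor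
  by_cases h : (k : ℕ) + 1 = N
  · rw [if_pos h, ← hEg, ← applyFun_eps_const_mul,
      ← applyFun_eps_add hgi ((integrableOn_phi ha hb N).const_mul _)]
    refine applyFun_eps_congr (fun y _ => ?_) x
    rw [hg]
    simp only
    rw [deriv_eq_skewImage_sub ha hb k, if_pos h]
    ring
  · rw [if_neg h, ← hEg, add_zero]
    refine applyFun_eps_congr (fun y _ => ?_) x
    rw [hg]
    simp only
    rw [deriv_eq_skewImage_sub ha hb k, if_neg h, sub_zero]

lemma continuousOn_rightFactor (ha : -2 < a) (hb : -2 < b) {N : ℕ} (k : Fin N) :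
    ContinuousOn (rightFactor a b N k) J :=
  (continuousOn_applyFun_eps (integrableOn_skewImage ha hb k)).congr fun _ hx =>
    (applyFun_eps_skewImage ha hb k hx).symm

end Orthonormal

end JacobiEnsemble

/-! ### Removing a one-column error by skew-symmetry. -/

namespace Matrix

/-- If a skew-symmetric matrix is inverted by a skew-symmetric matrix up to a column, it is inverted
exactly. -/
lemma mul_eq_one_of_skew {n K : Type*} [Fintype n] [DecidableEq n] [Field K] [CharZero K]
    {A D : Matrix n n K} (hA : Aᵀ = -A) (hdet : A.det ≠ 0) (hD : Dᵀ = -D) (l : n) (r : n → K)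
    (hAD : ∀ i k, (A * D) i k = (1 : Matrix n n K) i k + if k = l then r i else 0) :
    A * D = 1 := by
  have hu : IsUnit A.det := isUnit_iff_ne_zero.mpr hdet
  let R : Matrix n n K := of fun i k => if k = l then r i else 0
  have h1 : A * D = 1 + R := by
    ext i k
    rw [hAD]
    rfl
  have h2 : D = A⁻¹ + A⁻¹ * R := by
    rw [← mul_one_add, ← h1, ← Matrix.mul_assoc, nonsing_inv_mul A hu, Matrix.one_mul]
  have hAi : (A⁻¹)ᵀ = -A⁻¹ := by
    rw [transpose_nonsing_inv, hA]
    refine inv_eq_left_inv ?_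
    rw [neg_mul_neg, nonsing_inv_mul A hu]
  have h3 : (A⁻¹ * R)ᵀ = -(A⁻¹ * R) := by
    have : A⁻¹ * R = D - A⁻¹ := by rw [h2]; abel
    rw [this, transpose_sub, hD, hAi]
    abel
  have hent : ∀ i k, (A⁻¹ * R) i k = if k = l then (A⁻¹ *ᵥ r) i else 0 := by
    intro i k
    rw [mul_apply]
    by_cases h : k = l
    · simp [R, h, mulVec, dotProduct]
    · simp [R, h]
  -- The matrix A⁻¹R = D - A⁻¹ is skew and supported in column l. Its diagonal entry vanishes, and
  -- each other entry is minus one lying outside that column.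
  have hz : A⁻¹ * R = 0 := by
    have hsk : ∀ i k, (A⁻¹ * R) k i = -(A⁻¹ * R) i k := fun i k => congrFun (congrFun h3 i) k
    have hl : (A⁻¹ *ᵥ r) l = 0 := by
      have := hsk l l
      rw [hent, if_pos rfl] at this
      have h2 : (2 : K) * (A⁻¹ *ᵥ r) l = 0 := by linear_combination this
      simpa using h2
    ext i k
    rw [hent, zero_apply]
    split_ifs with h
    · by_cases hi : i = l
      · rw [hi, hl]
      · have := hsk l i
        rw [hent, hent, if_pos rfl, if_neg hi, neg_zero] at this
        exact this
    · rfl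
  rw [h2, hz, add_zero, mul_nonsing_inv A hu]

end Matrix

/-! ### Partition functions, the finite-rank form of T, and the conclusion. -/

namespace JacobiEnsemble

variable {a b : ℝ}

lemma det_coeff_normP_ne_zero (ha : -2 < a) (hb : -2 < b) (N : ℕ) :
    (Matrix.of fun i j : Fin N => (normP a b j).coeff i).det ≠ 0 := by
  have hα : -1 < a + 1 := by linarith
  have hβ : -1 < b + 1 := by linarith
  have hc : ∀ j, 1 / √(jacobiH (a + 1) (b + 1) j) ≠ 0 := fun j =>
    (one_div_pos.mpr (Real.sqrt_pos.mpr (jacobiH_pos hα hβ j))).ne'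
  have hdeg : ∀ j, (normP a b j).natDegree = j := fun j => by
    rw [normP, Polynomial.natDegree_C_mul (hc j), natDegree_jacobiP hα hβ]
  rw [Matrix.det_of_isUpperTriangular
    (Matrix.matrixOfPolynomials_blockTriangular _ fun i => (hdeg i).le)]
  refine Finset.prod_ne_zero_iff.mpr fun i _ => ?_
  have h0 : normP a b i ≠ 0 :=
    mul_ne_zero (Polynomial.C_ne_zero.mpr (hc i)) (jacobiP_ne_zero hα hβ i)
  have := Polynomial.leadingCoeff_ne_zero.mpr h0
  rwa [Polynomial.leadingCoeff, hdeg] at this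

lemma natDegree_normP_le (ha : -2 < a) (hb : -2 < b) (j : ℕ) : (normP a b j).natDegree ≤ j := by
  refine (Polynomial.natDegree_C_mul_le _ _).trans ?_
  rw [natDegree_jacobiP (by linarith) (by linarith)]

lemma partition_ne_zero (ha : -2 < a) (hb : -2 < b) (n : ℕ) :
    ∫ x in cube n, ((∏ j : Fin n, ∏ k ∈ Finset.Ioi j, |x j - x k| ^ 1 : ℝ) : ℂ) *
      ∏ j : Fin n, (weight a b (x j) : ℂ) ≠ 0 := by
  have hreal : ∫ x in cube n, ((∏ j : Fin n, ∏ k ∈ Finset.Ioi j, |x j - x k| ^ 1 : ℝ) : ℂ) *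
      ∏ j : Fin n, (weight a b (x j) : ℂ) =
      ((∫ x in cube n, |(Matrix.vandermonde x).det| * ∏ j : Fin n, weight a b (x j) : ℝ) : ℂ) := by
    rw [← integral_complex_ofReal]
    refine integral_congr_ae (Filter.Eventually.of_forall fun x => ?_)
    simp only
    rw [prod_abs_sub_eq_abs_det_vandermonde]
    push_cast
    rfl
  rw [hreal, Complex.ofReal_ne_zero]
  have hcont : Continuous fun x : Fin n → ℝ => |(Matrix.vandermonde x).det| := by
    simp_rw [Matrix.det_vandermonde]
    fun_prop
  have hcube : IsCompact (cube n) := isCompact_univ_pi fun _ => isCompact_Icc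
  have hmeas : MeasurableSet (cube n) := MeasurableSet.univ_pi fun _ => measurableSet_Icc
  have hw : IntegrableOn (fun x : Fin n → ℝ => ∏ j : Fin n, weight a b (x j)) (cube n) := by
    unfold IntegrableOn
    rw [volume_restrict_cube]
    exact Integrable.fintype_prod fun _ => integrableOn_jacobiWeight (by linarith) (by linarith)
  have hint := hw.continuousOn_mul hcont.continuousOn hcube
  refine (ne_of_gt ?_)
  rw [setIntegral_pos_iff_support_of_nonneg_ae
    ((ae_restrict_iff' hmeas).mpr (Filter.Eventually.of_forall fun x hx => ?_)) hint]
  · let U : Set (Fin n → ℝ) := {x | (Matrix.vandermonde x).det ≠ 0} ∩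
      Set.univ.pi fun _ => Set.Ioo (-1) 1
    have hUopen : IsOpen U := by
      refine IsOpen.inter ?_ (isOpen_set_pi Set.finite_univ fun _ _ => isOpen_Ioo)
      have : Continuous fun x : Fin n → ℝ => (Matrix.vandermonde x).det := by
        simp_rw [Matrix.det_vandermonde]
        fun_prop
      exact isOpen_ne_fun this continuous_const
    have hUne : U.Nonempty := by
      -- Distinct points of [0,1): the integrand is positive on an open set that contains them.
      refine ⟨fun j => (j : ℝ) / (n + 1), ?_, ?_⟩
      · refine Matrix.det_vandermonde_ne_zero_iff.mpr fun i j hij => ?_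
        have hn : (n : ℝ) + 1 ≠ 0 := by positivity
        have h : (i : ℝ) / (n + 1) = (j : ℝ) / (n + 1) := hij
        rw [div_left_inj' hn] at h
        exact Fin.ext (by exact_mod_cast h)
      · intro j _
        have hj : (j : ℝ) < n := by exact_mod_cast j.2
        have hn : (0 : ℝ) < n + 1 := by positivity
        refine ⟨lt_of_lt_of_le (by norm_num) (by positivity : (0 : ℝ) ≤ (j : ℝ) / (n + 1)), ?_⟩
        show (j : ℝ) / (n + 1) < 1
        rw [div_lt_one hn]
        linarith
    refine lt_of_lt_of_le (hUopen.measure_pos volume hUne) (measure_mono ?_)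
    rintro x ⟨hx1, hx2⟩
    refine ⟨?_, fun j _ => Set.Ioo_subset_Icc_self (hx2 j (Set.mem_univ j))⟩
    exact mul_ne_zero (abs_ne_zero.mpr hx1)
      (Finset.prod_ne_zero_iff.mpr fun j _ => (jacobiWeight_pos (hx2 j (Set.mem_univ j))).ne')
  · refine mul_nonneg (abs_nonneg _) (Finset.prod_nonneg fun j _ => ?_)
    have := hx j (Set.mem_univ j)
    exact mul_nonneg (Real.rpow_nonneg (by linarith [this.2]) _)
      (Real.rpow_nonneg (by linarith [this.1]) _)

/-- The skew moment matrix of the ensemble with weight `w (1 + f)`. -/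
noncomputable def skewMoment (a b : ℝ) (N : ℕ) (f : ℝ → ℂ) : Matrix (Fin N) (Fin N) ℂ :=
  Matrix.of fun i j => skewForm (fun x => phi a b i x * (1 + f x))
    (fun x => phi a b j x * (1 + f x))

lemma skewMoment_transpose (N : ℕ) (f : ℝ → ℂ) :
    (skewMoment a b N f).transpose = -skewMoment a b N f := by
  ext i j
  simp only [skewMoment, Matrix.transpose_apply, Matrix.neg_apply, Matrix.of_apply]
  exact skewForm_swap _ _

/-- The constant precedes f in the statement, so it cancels in the quotient defining `G`. Evenness
of N lets the indices be split into two copies of `Fin m`, as the Pfaffian requires. -/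
lemma partition_sq (ha : -2 < a) (hb : -2 < b) (N : ℕ) (hNe : Even N) :
    ∃ c : ℂ, c ≠ 0 ∧ ∀ f : ℝ → ℂ, ContinuousOn f J →
      (∫ x in cube N, ((∏ j : Fin N, ∏ k ∈ Finset.Ioi j, |x j - x k| ^ 1 : ℝ) : ℂ) *
        ∏ j : Fin N, ((weight a b (x j) : ℂ) * (1 + f (x j)))) ^ 2 =
      c * (skewMoment a b N f).det := by
  obtain ⟨m, rfl⟩ := hNe
  let e : Fin m ⊕ Fin m ≃ Fin (m + m) := finSumFinEquiv
  set κ : ℂ := (((Matrix.of fun i j : Fin (m + m) => (normP a b j).coeff i).det : ℝ) : ℂ) *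
    Matrix.pfaffianSum (epsIndex e) with hκdef
  have hκ : κ ≠ 0 := mul_ne_zero (Complex.ofReal_ne_zero.mpr (det_coeff_normP_ne_zero ha hb _))
    (pfaffianSum_epsIndex_ne_zero e)
  set F : ℂ := ((m + m).factorial : ℂ) with hF
  have hF0 : F ≠ 0 := Nat.cast_ne_zero.mpr (Nat.factorial_ne_zero _)
  refine ⟨(F * Matrix.pfaffianSum (Matrix.stdSkew (Fin m) ℂ) / κ) ^ 2,
    pow_ne_zero _ (div_ne_zero (mul_ne_zero hF0 Matrix.pfaffianSum_stdSkew_ne_zero) hκ), ?_⟩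
  intro f hf
  have hphi : ∀ j x, (((normP a b j).eval x : ℝ) : ℂ) * ((weight a b x : ℂ) * (1 + f x)) =
      phi a b j x * (1 + f x) := by
    intro j x
    rw [phi_eq, weight, jacobiWeight]
    push_cast
    ring
  have hpart := partition_mul_eq_pfaffianSum e (fun j => normP a b j)
    (fun j => natDegree_normP_le ha hb j) (fun x => (weight a b x : ℂ) * (1 + f x)) (by
      intro j
      simp_rw [hphi]
      exact (integrableOn_phi ha hb j).mul_continuousOn (continuousOn_const.add hf) isCompact_J)
  simp_rw [hphi] at hpart
  have hsub : (Matrix.of fun p q => skewForm (fun x => phi a b (e p) x * (1 + f x))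
      fun x => phi a b (e q) x * (1 + f x)) = (skewMoment a b (m + m) f).submatrix e e := rfl
  rw [hsub, ← hκdef, ← hF] at hpart
  have hskew : ((skewMoment a b (m + m) f).submatrix e e).transpose =
      -(skewMoment a b (m + m) f).submatrix e e := by
    rw [Matrix.transpose_submatrix, skewMoment_transpose]
    rfl
  have hsq := Matrix.pfaffianSum_sq _ hskew
  rw [Matrix.det_submatrix_equiv_self] at hsq
  rw [← mul_right_inj' (pow_ne_zero 2 hκ), ← mul_pow, hpart, mul_pow, hsq]
  field_simp

lemma integrableOn_leftFactor_mul_rightFactor (ha : -2 < a) (hb : -2 < b) {N : ℕ} {f : ℝ → ℂ}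
    (hf : ContDiffOn ℝ 1 f (Set.Icc (-1) 1)) (i k : Fin N) :
    IntegrableOn (fun x => leftFactor f (phi a b i) x * rightFactor a b N k x) J :=
  (integrableOn_leftFactor hf (integrableOn_phi ha hb i)).mul_continuousOn
    (continuousOn_rightFactor ha hb k) isCompact_J

/-- Biorthogonality yields the identity. The εφ_N correction affects only the last column and need
not be evaluated. -/
lemma skewForm_phi_skewImage (ha : -2 < a) (hb : -2 < b) {N : ℕ} (i k : Fin N) :
    skewForm (phi a b i) (skewImage a b N k) = (if i = k then 1 else 0) +
      if (k : ℕ) + 1 = N then ∫ x in J, phi a b i x *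
        ((skewCoeff a b (N - 1) : ℂ) * applyFun eps (phi a b N) x) else 0 := by
  have hφ := integrableOn_phi ha hb (i : ℕ)
  rw [integral_mul_applyFun_eps hφ (integrableOn_skewImage ha hb k)]
  have h1 : ∫ x in J, phi a b i x * applyFun eps (skewImage a b N k) x =
      ∫ x in J, (phi a b i x * ((1 - (x : ℂ) ^ 2) * phi a b k x) + phi a b i x *
        if (k : ℕ) + 1 = N then (skewCoeff a b k : ℂ) * applyFun eps (phi a b N) x else 0) := by
    refine integral_congr_ae (ae_J_of_forall fun x hx => ?_)
    simp only
    rw [applyFun_eps_skewImage ha hb k hx, rightFactor, mul_add]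
  rw [h1, integral_add (hφ.mul_continuousOn (continuousOn_one_sub_sq_mul_phi ha hb k) isCompact_J),
    integral_one_sub_sq_mul_phi_mul_phi ha hb]
  · simp only [Fin.val_inj]
    congr 1
    split_ifs with h
    · rw [show (k : ℕ) = N - 1 by omega]
    · simp
  · refine hφ.mul_continuousOn ?_ isCompact_J
    split_ifs
    · exact continuousOn_const.mul (continuousOn_applyFun_eps (integrableOn_phi ha hb N))
    · exact continuousOn_const

/-- Right multiplication by D replaces φ_j by `skewImage`, whose image under ε is the explicit
`rightFactor`; then `skewForm_one_add_mul` applies. -/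
lemma skewMoment_mul_skewMatrix (ha : -2 < a) (hb : -2 < b) {N : ℕ} {f : ℝ → ℂ}
    (hf : ContDiffOn ℝ 1 f (Set.Icc (-1) 1)) (hl : f (-1) = 0) (hr : f 1 = 0) (i k : Fin N) :
    (skewMoment a b N f * skewMatrix a b N) i k = skewForm (phi a b i) (skewImage a b N k) +
      ∫ x in J, leftFactor f (phi a b i) x * rightFactor a b N k x := by
  have hfc : ContinuousOn (fun x => 1 + f x) J := continuousOn_const.add hf.continuousOn
  have hφ : ∀ j, IntegrableOn (fun x => phi a b j x * (1 + f x)) J := fun j =>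
    (integrableOn_phi ha hb j).mul_continuousOn hfc isCompact_J
  have h1 : (skewMoment a b N f * skewMatrix a b N) i k =
      skewForm (fun x => phi a b i x * (1 + f x)) (fun x => skewImage a b N k x * (1 + f x)) := by
    have h2 : (fun x => skewImage a b N k x * (1 + f x)) = fun x => ∑ j : Fin N,
        skewMatrix a b N j k * (phi a b j x * (1 + f x)) := by
      funext x
      rw [skewImage, Finset.sum_mul]
      exact Finset.sum_congr rfl fun j _ => by ring
    rw [h2, skewForm_sum_right Finset.univ (fun j => skewMatrix a b N j k) _
      (fun j x => phi a b j x * (1 + f x)) (hφ i) fun j => hφ j]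
    rfl
  rw [h1, skewForm_one_add_mul hf hl hr (integrableOn_phi ha hb i) (integrableOn_skewImage ha hb k)
    (continuousOn_skewImage k)]
  congr 1
  refine integral_congr_ae (ae_J_of_forall fun x hx => ?_)
  simp only
  rw [applyFun_eps_skewImage ha hb k hx]

lemma skewMoment_zero_mul_skewMatrix_apply (ha : -2 < a) (hb : -2 < b) {N : ℕ} (i k : Fin N) :
    (skewMoment a b N 0 * skewMatrix a b N) i k = skewForm (phi a b i) (skewImage a b N k) := by
  rw [skewMoment_mul_skewMatrix ha hb (f := 0) contDiffOn_const rfl rfl]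
  have hzero : ∀ x, leftFactor 0 (phi a b i) x = 0 := by
    intro x
    have hd : derivWithin (0 : ℝ → ℂ) J x = 0 := by
      rw [show (0 : ℝ → ℂ) = fun _ => 0 from rfl]
      simp
    simp [leftFactor, hd]
  simp only [hzero, zero_mul, integral_zero, add_zero]

lemma skewMoment_zero_mul_skewMatrix (ha : -2 < a) (hb : -2 < b) {N : ℕ} (hN : 0 < N)
    (hdet : (skewMoment a b N 0).det ≠ 0) : skewMoment a b N 0 * skewMatrix a b N = 1 := by
  refine Matrix.mul_eq_one_of_skew (skewMoment_transpose N 0) hdet (skewMatrix_transpose N)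
    ⟨N - 1, by omega⟩ (fun i => ∫ x in J, phi a b i x *
        ((skewCoeff a b (N - 1) : ℂ) * applyFun eps (phi a b N) x)) fun i k => ?_
  rw [skewMoment_zero_mul_skewMatrix_apply ha hb, skewForm_phi_skewImage ha hb, Matrix.one_apply]
  congr 1
  have hiff : (k = (⟨N - 1, by omega⟩ : Fin N)) ↔ (k : ℕ) + 1 = N := by
    rw [Fin.ext_iff]
    have := k.2
    simp only
    omega
  simp only [hiff]

/-- Letting ε act to the left costs a sign by antisymmetry, which cancels the minus signs of the
compositions in `T`. -/
lemma comp_mulRight_eps (K : ℝ → ℝ → ℂ) (g : ℝ → ℂ) (x y : ℝ) :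
    comp K (mulRight eps g) x y = -applyFun eps (K x) y * g y := by
  unfold comp mulRight
  rw [← integral_mul_eps, ← integral_mul_const]
  simp_rw [mul_assoc]

lemma applyFun_eps_sum {ι : Type*} (s : Finset ι) (c : ι → ℂ) (h : ι → ℝ → ℂ)
    (hh : ∀ i, IntegrableOn (h i) J) (x : ℝ) :
    applyFun eps (fun y => ∑ i ∈ s, c i * h i y) x = ∑ i ∈ s, c i * applyFun eps (h i) x := by
  unfold applyFun
  simp_rw [← integral_const_mul]
  rw [← integral_finsetSum _ fun i _ => (integrable_eps_mul (hh i) x).const_mul _]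
  refine integral_congr_ae (Filter.Eventually.of_forall fun y => ?_)
  simp only
  rw [Finset.mul_sum]
  exact Finset.sum_congr rfl fun i _ => by ring

/-- The kernel `T` has finite rank. -/
lemma T_eq_sum (ha : -2 < a) (hb : -2 < b) {N : ℕ} (hN : 2 ≤ N) {f : ℝ → ℂ}
    (hf : ContDiffOn ℝ 1 f (Set.Icc (-1) 1)) (x y : ℝ) :
    T a b N f x y = ∑ k : Fin N, rightFactor a b N k x * leftFactor f (phi a b k) y := by
  have hφ := fun j : ℕ => integrableOn_phi ha hb j
  have hφf := fun j : ℕ => integrableOn_mul_left hf (integrableOn_phi ha hb j)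
  have hC : C a b N = skewCoeff a b (N - 1) := by
    obtain ⟨n, rfl⟩ := Nat.exists_eq_add_of_le' hN
    exact C_eq_skewCoeff ha hb n
  have hS : ∀ y, S a b N x y = ∑ k : Fin N, (1 - (x : ℂ) ^ 2) * phi a b k x * phi a b k y :=
    fun y => (Fin.sum_univ_eq_sum_range
      (fun k => (1 - (x : ℂ) ^ 2) * phi a b k x * phi a b k y) N).symm
  have h1 : applyFun eps (S a b N x) y =
      ∑ k : Fin N, (1 - (x : ℂ) ^ 2) * phi a b k x * applyFun eps (phi a b k) y := by
    rw [show S a b N x = fun y => ∑ k : Fin N, (1 - (x : ℂ) ^ 2) * phi a b k x * phi a b k y from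
      funext hS]
    exact applyFun_eps_sum _ (fun k : Fin N => (1 - (x : ℂ) ^ 2) * phi a b k x)
      (fun k => phi a b k) (fun k => hφ k) y
  have h2 : applyFun eps (mulRight (S a b N) f x) y = ∑ k : Fin N,
      (1 - (x : ℂ) ^ 2) * phi a b k x * applyFun eps (fun z => phi a b k z * f z) y := by
    rw [show mulRight (S a b N) f x = fun y => ∑ k : Fin N,
      (1 - (x : ℂ) ^ 2) * phi a b k x * (phi a b k y * f y) from funext fun z => by
        rw [mulRight, hS, Finset.sum_mul]
        exact Finset.sum_congr rfl fun k _ => by ring]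
    exact applyFun_eps_sum _ (fun k : Fin N => (1 - (x : ℂ) ^ 2) * phi a b k x)
      (fun k z => phi a b k z * f z) (fun k => hφf k) y
  have h3 : applyFun eps (mulRight (tensor (applyFun eps (phi a b N)) (phi a b (N - 1))) f x) y =
      applyFun eps (phi a b N) x * applyFun eps (fun z => phi a b (N - 1) z * f z) y := by
    rw [← applyFun_eps_const_mul]
    refine applyFun_eps_congr (fun z _ => ?_) y
    simp only [mulRight, tensor]
    ring
  -- The correction in `rightFactor` is present only for k = N - 1; it produces the three rank-one
  -- terms of `T`.
  have hsum : ∑ k : Fin N, rightFactor a b N k x * leftFactor f (phi a b k) y =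
      (∑ k : Fin N, (1 - (x : ℂ) ^ 2) * phi a b k x * leftFactor f (phi a b k) y) +
        (skewCoeff a b (N - 1) : ℂ) * applyFun eps (phi a b N) x *
          leftFactor f (phi a b (N - 1)) y := by
    simp only [rightFactor, add_mul, Finset.sum_add_distrib]
    congr 1
    rw [Finset.sum_eq_single (⟨N - 1, by omega⟩ : Fin N)]
    · rw [if_pos (by simp only; omega)]
    · intro j _ hj
      rw [if_neg, zero_mul]
      intro h
      exact hj (Fin.ext (by simp only; omega))
    · simp
  have hleft : ∑ k : Fin N, (1 - (x : ℂ) ^ 2) * phi a b k x * leftFactor f (phi a b k) y =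
      (∑ k : Fin N, (1 - (x : ℂ) ^ 2) * phi a b k x * phi a b k y) * (f y ^ 2 + 2 * f y) +
      ((∑ k : Fin N, (1 - (x : ℂ) ^ 2) * phi a b k x * applyFun eps (phi a b k) y) +
        ∑ k : Fin N, (1 - (x : ℂ) ^ 2) * phi a b k x *
          applyFun eps (fun z => phi a b k z * f z) y) * derivWithin f J y := by
    rw [← Finset.sum_add_distrib, Finset.sum_mul, Finset.sum_mul, ← Finset.sum_add_distrib]
    refine Finset.sum_congr rfl fun k _ => ?_
    rw [leftFactor]
    ring
  rw [hsum, hleft]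
  simp only [T, Pi.add_apply, Pi.sub_apply, Pi.smul_apply, smul_eq_mul, comp_mulRight_eps, h1, h2, h3]
  simp only [mulRight, hS, tensor, hC, leftFactor]
  ring

/-- The determinantal formula for the squared generating function of the Jacobi orthogonal
ensemble. -/
lemma summable_and_G_sq_eq_fredholmDet (ha : -2 < a) (hb : -2 < b) {N : ℕ} (hN : 2 ≤ N)
    (hNe : Even N) {f : ℝ → ℂ} (hf : ContDiffOn ℝ 1 f (Set.Icc (-1) 1)) (hl : f (-1) = 0)
    (hr : f 1 = 0) :
    Summable (fredholmTerm (T a b N f)) ∧ G 1 (weight a b) N f ^ 2 = fredholmDet (T a b N f) := by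
  obtain ⟨hsum, hdet⟩ := fredholmDet_of_finite_rank (rightFactor a b N)
    (fun k => leftFactor f (phi a b k)) (T a b N f) (T_eq_sum ha hb hN hf)
    (integrableOn_leftFactor_mul_rightFactor ha hb hf)
  refine ⟨hsum, ?_⟩
  obtain ⟨c, hc, hpart⟩ := partition_sq ha hb N hNe
  have hpf := hpart f hf.continuousOn
  have hp0 := hpart 0 continuousOn_const
  simp only [Pi.zero_apply, add_zero, mul_one] at hp0
  -- Positivity of the partition function gives the invertibility of A_0.
  have hdet0 : (skewMoment a b N 0).det ≠ 0 := by
    intro h0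
    rw [h0, mul_zero] at hp0
    exact partition_ne_zero ha hb N (pow_eq_zero_iff two_ne_zero |>.mp hp0)
  have hone := skewMoment_zero_mul_skewMatrix ha hb (by omega : 0 < N) hdet0
  have hmul : skewMoment a b N f * skewMatrix a b N = 1 + Matrix.of fun i k : Fin N =>
      ∫ x in J, leftFactor f (phi a b i) x * rightFactor a b N k x := by
    ext i k
    rw [skewMoment_mul_skewMatrix ha hb hf hl hr, ← skewMoment_zero_mul_skewMatrix_apply ha hb, hone]
    rfl
  -- From det A_0 · det D = 1, the determinant of A_f D is det A_f / det A_0, the ratio of squared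
  -- partition functions.
  have h1 := congrArg Matrix.det hone
  rw [Matrix.det_mul, Matrix.det_one] at h1
  rw [hdet, ← hmul, Matrix.det_mul, G, div_pow, hpf, hp0, div_eq_iff (mul_ne_zero hc hdet0)]
  linear_combination (-(c * (skewMoment a b N f).det)) * h1

end JacobiEnsemble

theorem mainTheorem2 (a b : ℝ) (ha : -2 < a) (hb : -2 < b) (N : ℕ) (hN : 0 < N) (hNe : Even N)
    (f : ℝ → ℂ) (hf : ContDiffOn ℝ 1 f (Set.Icc (-1) 1)) (hf_left : f (-1) = 0)
    (hf_right : f 1 = 0) :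
    Summable (JacobiEnsemble.fredholmTerm (JacobiEnsemble.T a b N f)) ∧
      JacobiEnsemble.G 1 (JacobiEnsemble.weight a b) N f ^ 2 =
        JacobiEnsemble.fredholmDet (JacobiEnsemble.T a b N f) := by
  have hN2 : 2 ≤ N := by
    obtain ⟨m, rfl⟩ := hNe
    omega
  exact JacobiEnsemble.summable_and_G_sq_eq_fredholmDet ha hb hN2 hNe hf hf_left hf_right
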